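/- **Theorem.** Let $F=(f_1,\dots,f_N)$ be a system of polynomials in $\mathbb C[x_1,\dots,x_n]$ with Jacobian matrix $A(x)$, and let $x^*\in\mathbb C^n$ be an isolated solution of $F(x)=0$ (the only solution in some ball around it). Let $m$ be its multiplicity, $m=\dim_{\mathbb C}\mathcal O_{x^*}/\langle F\rangle\mathcal O_{x^*}$, where $\mathcal O_{x^*}$ is the localization of $\mathbb C[x_1,\dots,x_n]$ at the maximal ideal of $x^*$. Call a solution *regular* if the Jacobian matrix there has full column rank, and *singular* otherwise. One *deflation* at a singular solution $x^*$ is the following step. Let $r=\operatorname{rank}A(x^*)$, choose a random matrix $B\in\mathbb C^{n\times(r+1)}$ and a random vector $h\in\mathbb C^{r+1}$, introduce $r+1$ new unknowns $\lambda=(\lambda_1,\dots,\lambda_{r+1})$, and replace $F$ by the system $$F(x)=0,\qquad A(x)B\lambda=0,\qquad h_1\lambda_1+\dots+h_{r+1}\lambda_{r+1}-1=0$$ in the unknowns $(x,\lambda)$, and $x^*$ by the solution $(x^*,\lambda^*)$ of this system. A property holds for random $(B,h)$ if it holds for all $(B,h)$ outside some proper algebraic subset of $\mathbb C^{n\times(r+1)}\times\mathbb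 C^{r+1}$ (which may depend on the current system and its solution). 1. Apply deflations repeatedly, with random choices at every stage, until the current solution is regular. At every stage $\lambda^*$ exists and is unique and $(x^*,\lambda^*)$ is an isolated solution of the deflated system, and a regular root is reached after at most $k$ deflations, for some $k<m$ that does not depend on the choices. At that root Newton's method $y\mapsto y-A^+(y)F(y)$ for the final system (with $A^+$ the Moore–Penrose inverse of its Jacobian matrix) converges quadratically: there are $\varepsilon>0$ and $K$ such that for every starting point $u_0$ within distance $\varepsilon$ of the root $z$ the iterates $u_k$ converge to $z$, with $\|u_{k+1}-u_{k+2}\|\le K\|u_k-u_{k+1}\|^2$ and $\|u_{k+1}-z\|\le K\|u_k-z\|^2$ for all $k\ge 0$. 2. If $x^*$ is singular, then for random $(B,h)$ the vector $\lambda^*$ exists and is unique, and $(x^*,\lambda^*)$ is an isolated solution of the deflated system whose multiplicity is positive and strictly less than $m$. 3. $m=1$ if and only if $x^*$ is regular. -/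

import Mathlib

open MvPolynomial Matrix Filter Topology

noncomputable section

namespace Deflation

/-! ### Polynomial systems, isolated solutions, Jacobians -/

/-- The value `F(x)` of a polynomial system. -/
def evalSystem {σ ι : Type} (F : ι → MvPolynomial σ ℂ) (x : σ → ℂ) : ι → ℂ :=
  fun i => eval x (F i)

/-- `x` is an isolated solution of `F = 0`: in some ball around `x` it is the only solution.
(The norm on `σ → ℂ` is the maximum norm; all norms on this space are equivalent.) -/
def IsIsolatedSolution {σ ι : Type} [Fintype σ] (F : ι → MvPolynomial σ ℂ) (x : σ → ℂ) : Prop :=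
  ∃ ε : ℝ, 0 < ε ∧ {y : σ → ℂ | ‖y - x‖ < ε} ∩ {y : σ → ℂ | evalSystem F y = 0} = {x}

/-- The Jacobian matrix `A(x)` of the system, evaluated at the point `x`. -/
def jacobianAt {σ ι : Type} (F : ι → MvPolynomial σ ℂ) (x : σ → ℂ) : Matrix ι σ ℂ :=
  Matrix.of fun i j => eval x (pderiv j (F i))

/-- The Jacobian matrix at `x` has full column rank, the number of unknowns. A solution with this
property is a regular root, any other solution is singular. -/
def IsRegularAt {σ ι : Type} [Fintype σ] (F : ι → MvPolynomial σ ℂ) (x : σ → ℂ) : Prop :=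
  (jacobianAt F x).rank = Fintype.card σ

/-! ### Local multiplicity -/

/-- The maximal ideal of the polynomials that vanish at `x`. -/
abbrev pointIdeal {σ : Type} (x : σ → ℂ) : Ideal (MvPolynomial σ ℂ) :=
  RingHom.ker (eval x)

instance pointIdeal_isPrime {σ : Type} (x : σ → ℂ) : (pointIdeal x).IsPrime :=
  RingHom.ker_isPrime _

/-- The local ring at `x`: the localization of the polynomial ring at the maximal ideal of `x`. -/
abbrev LocalRingAt {σ : Type} (x : σ → ℂ) : Type :=
  Localization.AtPrime (pointIdeal x)

/-- The extension to the local ring at `x` of the ideal generated by the polynomials of `F`. -/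
abbrev localIdeal {σ ι : Type} (F : ι → MvPolynomial σ ℂ) (x : σ → ℂ) : Ideal (LocalRingAt x) :=
  (Ideal.span (Set.range F)).map (algebraMap (MvPolynomial σ ℂ) (LocalRingAt x))

/-- The multiplicity of `x` as a solution of `F = 0`: the dimension over `ℂ` of the local ring at
`x` modulo the extension of the ideal of the system. -/
def multiplicity {σ ι : Type} (F : ι → MvPolynomial σ ℂ) (x : σ → ℂ) : ℕ :=
  Module.finrank ℂ (LocalRingAt x ⧸ localIdeal F x)

/-! ### Newton's method (Gauss-Newton) -/

/-- The four Penrose conditions: `P` is the Moore-Penrose inverse of `A`. -/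
structure IsMoorePenrose {m n : Type} [Fintype m] [Fintype n]
    (A : Matrix m n ℂ) (P : Matrix n m ℂ) : Prop where
  mul_mul_self : A * P * A = A
  self_mul_mul : P * A * P = P
  isHermitian_left : (A * P)ᴴ = A * P
  isHermitian_right : (P * A)ᴴ = P * A

theorem IsMoorePenrose.unique {m n : Type} [Fintype m] [Fintype n]
    {A : Matrix m n ℂ} {P Q : Matrix n m ℂ} (hP : IsMoorePenrose A P) (hQ : IsMoorePenrose A Q) :
    P = Q := by
  have h1 : A * P = A * Q := by
    calc A * P = (A * Q * A) * P := by rw [hQ.mul_mul_self]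
      _ = (A * Q)ᴴ * (A * P)ᴴ := by
        rw [hQ.isHermitian_left, hP.isHermitian_left, Matrix.mul_assoc]
      _ = ((A * P * A) * Q)ᴴ := by rw [← conjTranspose_mul, ← Matrix.mul_assoc]
      _ = A * Q := by rw [hP.mul_mul_self, hQ.isHermitian_left]
  have h2 : P * A = Q * A := by
    calc P * A = P * (A * Q * A) := by rw [hQ.mul_mul_self]
      _ = (P * A)ᴴ * (Q * A)ᴴ := by
        rw [hQ.isHermitian_right, hP.isHermitian_right]; simp only [Matrix.mul_assoc]
      _ = (Q * (A * P * A))ᴴ := by rw [← conjTranspose_mul]; simp only [Matrix.mul_assoc]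
      _ = Q * A := by rw [hP.mul_mul_self, hQ.isHermitian_right]
  calc P = P * (A * P) := by rw [← Matrix.mul_assoc, hP.self_mul_mul]
    _ = (P * A) * Q := by rw [h1, Matrix.mul_assoc]
    _ = Q := by rw [h2, hQ.self_mul_mul]

theorem exists_isMoorePenrose {m n : Type} [Fintype m] [Fintype n] (A : Matrix m n ℂ) :
    ∃ P : Matrix n m ℂ, IsMoorePenrose A P := by
  classical
  have hH : (Aᴴ * A).IsHermitian := isHermitian_conjTranspose_mul_self A
  obtain ⟨G, hG, hGH, hHGH, hGHG⟩ : ∃ G : Matrix n n ℂ, Gᴴ = G ∧ (G * (Aᴴ * A))ᴴ = G * (Aᴴ * A) ∧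
      (Aᴴ * A) * G * (Aᴴ * A) = Aᴴ * A ∧ G * (Aᴴ * A) * G = G := by
    set U : Matrix n n ℂ := (hH.eigenvectorUnitary : Matrix n n ℂ) with hU
    have hUU : Uᴴ * U = 1 := by
      simpa [star_eq_conjTranspose] using Unitary.coe_star_mul_self hH.eigenvectorUnitary
    set d : n → ℂ := fun i => (hH.eigenvalues i : ℂ) with hd
    have hs : Aᴴ * A = U * diagonal d * Uᴴ := by
      have := hH.spectral_theorem
      rw [Unitary.conjStarAlgAut_apply] at this
      exact this
    have key : ∀ a b : n → ℂ, (U * diagonal a * Uᴴ) * (U * diagonal b * Uᴴ)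
        = U * diagonal (fun i => a i * b i) * Uᴴ := by
      intro a b
      calc (U * diagonal a * Uᴴ) * (U * diagonal b * Uᴴ)
          = U * diagonal a * (Uᴴ * U) * diagonal b * Uᴴ := by simp only [Matrix.mul_assoc]
        _ = _ := by rw [hUU, Matrix.mul_one, Matrix.mul_assoc U, diagonal_mul_diagonal]
    have keyH : ∀ a : n → ℂ, (∀ i, star (a i) = a i) →
        (U * diagonal a * Uᴴ)ᴴ = U * diagonal a * Uᴴ := by
      intro a ha
      have : star a = a := funext ha
      simp [conjTranspose_mul, Matrix.mul_assoc, diagonal_conjTranspose, this]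
    refine ⟨U * diagonal (fun i => (d i)⁻¹) * Uᴴ, ?_, ?_, ?_, ?_⟩
    · exact keyH _ fun i => by simp [hd]
    · rw [hs, key]
      exact keyH _ fun i => by simp [hd]
    · rw [hs, key, key]
      congr 3
      funext i
      exact mul_inv_mul_cancel (d i)
    · rw [hs, key, key]
      congr 3
      funext i
      by_cases h0 : d i = 0 <;> simp [h0]
  refine ⟨G * Aᴴ, ?_, ?_, ?_, ?_⟩
  · have hz : (A * G * (Aᴴ * A) - A)ᴴ * (A * G * (Aᴴ * A) - A) = 0 := by
      have h1 : (A * G * (Aᴴ * A))ᴴ = (Aᴴ * A) * G * Aᴴ := by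
        simp [conjTranspose_mul, hG, Matrix.mul_assoc]
      rw [conjTranspose_sub, h1, Matrix.sub_mul, Matrix.mul_sub, Matrix.mul_sub]
      have h2 : Aᴴ * A * G * Aᴴ * (A * G * (Aᴴ * A)) = Aᴴ * A := by
        calc _ = (Aᴴ * A * G * (Aᴴ * A)) * G * (Aᴴ * A) := by simp only [Matrix.mul_assoc]
          _ = _ := by rw [hHGH, hHGH]
      have h3 : Aᴴ * A * G * Aᴴ * A = Aᴴ * A := by
        rw [Matrix.mul_assoc (Aᴴ * A * G), hHGH]
      have h4 : Aᴴ * (A * G * (Aᴴ * A)) = Aᴴ * A := by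
        calc _ = Aᴴ * A * G * (Aᴴ * A) := by simp only [Matrix.mul_assoc]
          _ = _ := hHGH
      rw [h2, h3, h4]; simp
    open scoped ComplexOrder in
    have := sub_eq_zero.mp (conjTranspose_mul_self_eq_zero.mp hz)
    simpa only [Matrix.mul_assoc] using this
  · calc G * Aᴴ * A * (G * Aᴴ) = (G * (Aᴴ * A) * G) * Aᴴ := by simp only [Matrix.mul_assoc]
      _ = _ := by rw [hGHG]
  · simp [conjTranspose_mul, hG, Matrix.mul_assoc]
  · simpa only [Matrix.mul_assoc] using hGH

/-- The Moore-Penrose inverse `A⁺` of a complex matrix. -/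
def pinv {m n : Type} [Fintype m] [Fintype n] (A : Matrix m n ℂ) : Matrix n m ℂ :=
  (exists_isMoorePenrose A).choose

theorem pinv_spec {m n : Type} [Fintype m] [Fintype n] (A : Matrix m n ℂ) :
    IsMoorePenrose A (pinv A) :=
  (exists_isMoorePenrose A).choose_spec

/-- One step of Newton's method (the Gauss-Newton method when there are more equations than
unknowns): `x ↦ x - A(x)⁺ F(x)`. -/
def newtonStep {σ ι : Type} [Fintype σ] [Fintype ι] (F : ι → MvPolynomial σ ℂ) (x : σ → ℂ) :
    σ → ℂ :=
  x - pinv (jacobianAt F x) *ᵥ evalSystem F x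

/-- Newton's method for `F` converges quadratically to `x`: from every starting point near enough
to `x` the iterates converge to `x`, the size of each correction is bounded by a constant times the
square of the preceding one, and likewise for the errors. -/
def NewtonConvergesQuadratically {σ ι : Type} [Fintype σ] [Fintype ι]
    (F : ι → MvPolynomial σ ℂ) (x : σ → ℂ) : Prop :=
  ∃ ε : ℝ, 0 < ε ∧ ∃ K : ℝ, ∀ u : ℕ → σ → ℂ, ‖u 0 - x‖ < ε →
    (∀ k, u (k + 1) = newtonStep F (u k)) →
      Tendsto u atTop (𝓝 x) ∧
      (∀ k, ‖u (k + 1) - u (k + 2)‖ ≤ K * ‖u k - u (k + 1)‖ ^ 2) ∧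
      (∀ k, ‖u (k + 1) - x‖ ≤ K * ‖u k - x‖ ^ 2)

/-! ### The deflation method -/

/-- The deflated system in the unknowns `(x, λ)`:
`F(x) = 0`, `A(x) B λ = 0`, `h₁ λ₁ + ⋯ + hₛ λₛ - 1 = 0`. -/
def deflate {σ ι : Type} [Fintype σ] (F : ι → MvPolynomial σ ℂ) {s : ℕ}
    (B : Matrix σ (Fin s) ℂ) (h : Fin s → ℂ) : ι ⊕ (ι ⊕ Unit) → MvPolynomial (σ ⊕ Fin s) ℂ :=
  Sum.elim (fun i => rename Sum.inl (F i))
    (Sum.elim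
      (fun i => ∑ k : Fin s,
        (∑ j : σ, rename Sum.inl (pderiv j (F i)) * C (B j k)) * X (Sum.inr k))
      (fun _ => ∑ k : Fin s, C (h k) * X (Sum.inr k) - 1))

/-- `p B h` holds for random (generic) `B` and `h`, that is with probability one: the exceptional
pairs `(B, h)` lie in a proper algebraic subset, the zero set of a nonzero polynomial in the
entries of `B` and `h`. -/
def ForGeneric {σ : Type} {s : ℕ} (p : Matrix σ (Fin s) ℂ → (Fin s → ℂ) → Prop) : Prop :=
  ∃ Q : MvPolynomial ((σ × Fin s) ⊕ Fin s) ℂ, Q ≠ 0 ∧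
    ∀ (B : Matrix σ (Fin s) ℂ) (h : Fin s → ℂ),
      eval (Sum.elim (fun jk => B jk.1 jk.2) h) Q ≠ 0 → p B h

/-- `l` is the one and only vector of multipliers for which `(x, l)` solves the deflated system. -/
def IsMultiplier {σ ι : Type} [Fintype σ] (F : ι → MvPolynomial σ ℂ) (x : σ → ℂ) {s : ℕ}
    (B : Matrix σ (Fin s) ℂ) (h : Fin s → ℂ) (l : Fin s → ℂ) : Prop :=
  ∀ l' : Fin s → ℂ, evalSystem (deflate F B h) (Sum.elim x l') = 0 ↔ l' = l

/-- The deflation method, applied to the system `F` at its solution `x`, needs at most `k`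
deflations. If `x` is a regular root, no deflation is made, and Newton's method has to converge
quadratically to `x`. If `x` is singular, one deflation is made, with `r + 1` multipliers for
`r = rank A(x)` and random `B` and `h`: it has to determine the multipliers `l` uniquely, to have
`(x, l)` as an isolated solution, and to leave a system that needs at most `k - 1` deflations at
`(x, l)`. -/
def NeedsAtMost : ℕ → ∀ {σ ι : Type} [Fintype σ] [Fintype ι],
    (ι → MvPolynomial σ ℂ) → (σ → ℂ) → Prop
  | 0, _, _, _, _, F, x => IsRegularAt F x ∧ NewtonConvergesQuadratically F x
  | k + 1, σ, _, _, _, F, x =>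
      (IsRegularAt F x ∧ NewtonConvergesQuadratically F x) ∨
      (¬ IsRegularAt F x ∧
        ForGeneric fun (B : Matrix σ (Fin ((jacobianAt F x).rank + 1)) ℂ)
            (h : Fin ((jacobianAt F x).rank + 1) → ℂ) =>
          ∃ l, IsMultiplier F x B h l ∧
            IsIsolatedSolution (deflate F B h) (Sum.elim x l) ∧
            NeedsAtMost k (deflate F B h) (Sum.elim x l))

end Deflation

end

noncomputable section

namespace Deflation

/-! ### The local ring at a point -/

section LocalRing

variable {σ : Type} (x : σ → ℂ)

/-! The heart of the matter is that deflation lowers the multiplicity. At a singular solution of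
Jacobian rank `r`, the matrix `A(x)B` has `r + 1` columns and rank at most `r`, so it has a kernel.
For random `B` and `h` the matrix `A(x)B` stacked on `h` is injective, so the kernel is a line on
which `h` is nonzero, and the normalization singles out one multiplier vector `l`. By Cramer's rule
the multipliers become fractions `u / q` in the old unknowns modulo the deflated ideal, with `q(x) ≠
0` (`IsMultiplier.exists_fraction`). Hence the new local algebra is a quotient of the old one.

If this quotient were not proper, every entry of `A B u` would already lie in the local ideal of
`F`: the vector field `v = B u` would map each `F i` into that ideal and so preserve it. Some power
of `X j - x j` lies in the ideal; in characteristic zero, differentiating the lowest such power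
forces `v(x) = 0` (`eval_vectorField_eq_zero`). But `v(x) = q(x) B l ≠ 0`, since a random `B` is
injective.

Nilpotency and finite multiplicity require passing from topological to algebraic isolation: a prime
that contains `F` and lies in the maximal ideal of `x` must equal it
(`ker_eq_pointIdeal_of_isolated`). By Noether normalization, a positive-dimensional variety through
`x` would have other points arbitrarily near `x`.

Multiplicity one means that the local ideal is maximal, which Taylor expansion and Nakayama's lemma
identify with full column rank. Induction on the multiplicity then bounds the number of deflations
by `m - 1`. At a regular root the Newton error is `A⁺(u) (A(u)(u - x) - F(u))`, whose last factor
vanishes to second order. -/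

theorem sub_C_eval_mem_span (p : MvPolynomial σ ℂ) :
    p - C (eval x p) ∈ Ideal.span (Set.range fun j => (X j - C (x j) : MvPolynomial σ ℂ)) := by
  induction p using MvPolynomial.induction_on with
  | C a => simp
  | add p q hp hq =>
    have := Ideal.add_mem _ hp hq
    convert this using 1
    simp only [map_add]; ring
  | mul_X p j hp =>
    have h1 := Ideal.mul_mem_right (X j) _ hp
    have h2 := Ideal.mul_mem_left _ (C (eval x p))
      (Ideal.subset_span (Set.mem_range_self j) : (X j - C (x j) : MvPolynomial σ ℂ) ∈
        Ideal.span (Set.range fun j => (X j - C (x j) : MvPolynomial σ ℂ)))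
    convert Ideal.add_mem _ h1 h2 using 1
    simp only [map_mul, eval_X]; ring

theorem pointIdeal_eq_span :
    pointIdeal x = Ideal.span (Set.range fun j => (X j - C (x j) : MvPolynomial σ ℂ)) := by
  apply le_antisymm
  · intro p hp
    have := sub_C_eval_mem_span x p
    rw [RingHom.mem_ker] at hp
    simpa [hp] using this
  · rw [Ideal.span_le]
    rintro _ ⟨j, rfl⟩
    simp [RingHom.mem_ker]

theorem X_sub_C_mem_pointIdeal (j : σ) : (X j - C (x j) : MvPolynomial σ ℂ) ∈ pointIdeal x := by
  simp [RingHom.mem_ker]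

/-- The first-order Taylor formula modulo the square of the maximal ideal of a point. -/
theorem taylor_mem_pointIdeal_sq [Fintype σ] (p : MvPolynomial σ ℂ) :
    p - C (eval x p) - ∑ j, C (eval x (pderiv j p)) * (X j - C (x j)) ∈ pointIdeal x ^ 2 := by
  classical
  induction p using MvPolynomial.induction_on with
  | C a => simp
  | add p q hp hq =>
    convert Ideal.add_mem _ hp hq using 1
    simp only [map_add, add_mul, Finset.sum_add_distrib]; ring
  | mul_X p k hp =>
    have h1 := Ideal.mul_mem_right (X k) _ hp
    have h2 : (∑ j, C (eval x (pderiv j p)) * (X j - C (x j))) * (X k - C (x k)) ∈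
        pointIdeal x ^ 2 := by
      rw [pow_two]
      refine Ideal.mul_mem_mul (Ideal.sum_mem _ fun j _ => Ideal.mul_mem_left _ _ ?_) ?_
      · exact X_sub_C_mem_pointIdeal x j
      · exact X_sub_C_mem_pointIdeal x k
    convert Ideal.add_mem _ h1 h2 using 1
    have : ∀ j, eval x (pderiv j (p * X k)) =
        eval x (pderiv j p) * x k + eval x p * (if j = k then 1 else 0) := by
      intro j
      rw [Derivation.leibniz]
      by_cases h : j = k
      · subst h; simp; ring
      · simp [pderiv_X_of_ne (Ne.symm h), h]; ring
    simp only [this, map_add, map_mul, add_mul, Finset.sum_add_distrib, eval_X]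
    have e1 : ∑ j, C (eval x p) * C (if j = k then (1 : ℂ) else 0) * (X j - C (x j)) =
        (C (eval x p) * (X k - C (x k)) : MvPolynomial σ ℂ) := by
      rw [Finset.sum_eq_single k]
      · simp
      · intro b _ hb; simp [hb]
      · simp
    have e2 : ∑ j, C (eval x (pderiv j p)) * C (x k) * (X j - C (x j)) =
        (∑ j, C (eval x (pderiv j p)) * (X j - C (x j)) : MvPolynomial σ ℂ) * C (x k) := by
      rw [Finset.sum_mul]; exact Finset.sum_congr rfl fun _ _ => by ring
    rw [e1, e2]
    ring

theorem mem_primeCompl_pointIdeal {p : MvPolynomial σ ℂ} :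
    p ∈ (pointIdeal x).primeCompl ↔ eval x p ≠ 0 := by
  simp [Ideal.primeCompl, RingHom.mem_ker]

/-- The extension to the local ring at `x` of a homomorphism that makes every polynomial that does
not vanish at `x` invertible. -/
def localLift {S : Type} [CommRing S] [Algebra ℂ S] (f : MvPolynomial σ ℂ →ₐ[ℂ] S)
    (hf : ∀ q, eval x q ≠ 0 → IsUnit (f q)) : LocalRingAt x →ₐ[ℂ] S :=
  IsLocalization.liftAlgHom (M := (pointIdeal x).primeCompl) (f := f)
    fun q => hf q ((mem_primeCompl_pointIdeal x).1 q.2)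

theorem localLift_algebraMap {S : Type} [CommRing S] [Algebra ℂ S] (f : MvPolynomial σ ℂ →ₐ[ℂ] S)
    (hf : ∀ q, eval x q ≠ 0 → IsUnit (f q)) (p : MvPolynomial σ ℂ) :
    localLift x f hf (algebraMap _ _ p) = f p := by
  simp [localLift]

/-- Evaluation at `x` on the local ring at `x`. -/
def localEval : LocalRingAt x →ₐ[ℂ] ℂ :=
  localLift x (aeval x) fun _ hq => isUnit_iff_ne_zero.2 hq

@[simp] theorem localEval_algebraMap (p : MvPolynomial σ ℂ) :
    localEval x (algebraMap _ _ p) = eval x p :=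
  localLift_algebraMap x _ _ p

theorem isUnit_algebraMap_of_eval_ne_zero {p : MvPolynomial σ ℂ} (hp : eval x p ≠ 0) :
    IsUnit (algebraMap _ (LocalRingAt x) p) :=
  IsLocalization.map_units (M := (pointIdeal x).primeCompl) (LocalRingAt x)
    ⟨p, (mem_primeCompl_pointIdeal x).2 hp⟩

theorem exists_mul_algebraMap_eq (a : LocalRingAt x) : ∃ p q : MvPolynomial σ ℂ, eval x q ≠ 0 ∧
    a * algebraMap _ _ q = algebraMap _ _ p := by
  obtain ⟨⟨p, q⟩, h⟩ := IsLocalization.surj (pointIdeal x).primeCompl a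
  exact ⟨p, q, (mem_primeCompl_pointIdeal x).1 q.2, h⟩

theorem isUnit_iff_localEval_ne_zero {a : LocalRingAt x} : IsUnit a ↔ localEval x a ≠ 0 := by
  refine ⟨fun h => (h.map (localEval x)).ne_zero, fun h => ?_⟩
  obtain ⟨p, q, hq, e⟩ := exists_mul_algebraMap_eq x a
  have hp : eval x p ≠ 0 := by
    rw [← localEval_algebraMap, ← e, map_mul, localEval_algebraMap]
    exact mul_ne_zero h hq
  exact isUnit_of_mul_isUnit_left (e ▸ isUnit_algebraMap_of_eval_ne_zero x hp)

theorem maximalIdeal_eq_ker : IsLocalRing.maximalIdeal (LocalRingAt x) =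
    RingHom.ker (localEval x) := by
  ext a
  rw [IsLocalRing.mem_maximalIdeal, mem_nonunits_iff, isUnit_iff_localEval_ne_zero, not_not]
  rfl

theorem algebraMap_mem_map_iff (I : Ideal (MvPolynomial σ ℂ)) (p : MvPolynomial σ ℂ) :
    algebraMap _ (LocalRingAt x) p ∈ I.map (algebraMap _ (LocalRingAt x)) ↔
      ∃ s, eval x s ≠ 0 ∧ s * p ∈ I := by
  rw [IsLocalization.algebraMap_mem_map_algebraMap_iff (pointIdeal x).primeCompl]
  simp only [mem_primeCompl_pointIdeal]

variable {ι : Type} {F : ι → MvPolynomial σ ℂ}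

theorem localIdeal_le_ker (hF : evalSystem F x = 0) :
    localIdeal F x ≤ RingHom.ker (localEval x) := by
  rw [Ideal.map_le_iff_le_comap, Ideal.span_le]
  rintro _ ⟨i, rfl⟩
  have := congrFun hF i
  simpa [RingHom.mem_ker, evalSystem] using this

theorem algebraMap_mem_localIdeal (i : ι) : algebraMap _ _ (F i) ∈ localIdeal F x :=
  Ideal.mem_map_of_mem _ (Ideal.subset_span ⟨i, rfl⟩)

/-- The evaluation at a solution `x` on the local algebra of the system at `x`. -/
def quotEval (hF : evalSystem F x = 0) : (LocalRingAt x ⧸ localIdeal F x) →ₐ[ℂ] ℂ :=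
  Ideal.Quotient.liftₐ _ (localEval x) fun _ ha => localIdeal_le_ker x hF ha

@[simp] theorem quotEval_mk (hF : evalSystem F x = 0) (a : LocalRingAt x) :
    quotEval x hF (Ideal.Quotient.mk _ a) = localEval x a := rfl

theorem nontrivial_quot (hF : evalSystem F x = 0) :
    Nontrivial (LocalRingAt x ⧸ localIdeal F x) :=
  (quotEval x hF).toRingHom.domain_nontrivial

end LocalRing

/-! ### Isolated solutions are algebraically isolated -/

/-- A monic complex polynomial with a small constant term has a small root. -/
theorem exists_root_norm_lt {p : Polynomial ℂ} (hp : p.Monic) {δ : ℝ} (hδ : 0 < δ)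
    (h : ‖p.coeff 0‖ < δ ^ p.natDegree) : ∃ t, p.eval t = 0 ∧ ‖t‖ < δ := by
  by_contra! hc
  have hs := IsAlgClosed.splits p
  have h1 := hs.coeff_zero_eq_prod_roots_of_monic hp
  have h2 : ‖p.coeff 0‖ = (p.roots.map (‖·‖)).prod := by
    rw [h1, norm_mul, norm_pow, norm_neg, norm_one, one_pow, one_mul]
    exact map_multiset_prod (normHom : ℂ →*₀ ℝ) p.roots
  have key : ∀ s : Multiset ℂ, (∀ t ∈ s, δ ≤ ‖t‖) → δ ^ s.card ≤ (s.map (‖·‖)).prod := by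
    intro s
    induction s using Multiset.induction_on with
    | empty => simp
    | cons a s ih =>
      intro hs
      rw [Multiset.card_cons, pow_succ', Multiset.map_cons, Multiset.prod_cons]
      exact mul_le_mul (hs a (by simp)) (ih fun t ht => hs t (by simp [ht])) (by positivity)
        (norm_nonneg _)
  have h3 := key p.roots fun t ht => hc t ((Polynomial.mem_roots'.1 ht).2)
  rw [IsAlgClosed.card_roots_eq_natDegree, ← h2] at h3
  exact absurd h (not_lt.2 h3)

/-- Lying over, applied to `B[X] → A`, `X ↦ f`, instead of `B → A`, so that the value of `f` at the
lifted point can be prescribed along with the point of the base. -/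
theorem exists_ringHom_of_root_minpoly {B A K : Type} [CommRing B] [IsDomain B]
    [IsIntegrallyClosed B] [CommRing A] [IsDomain A] [Algebra B A] [Module.IsTorsionFree B A]
    [Algebra.IsIntegral B A] [Field K] [IsAlgClosed K] (φ : B →+* K) (f : A) (t : K)
    (ht : (minpoly B f).eval₂ φ t = 0) :
    ∃ ψ : A →+* K, ψ.comp (algebraMap B A) = φ ∧ ψ f = t := by
  let e : Polynomial B →+* A := (Polynomial.aeval f : Polynomial B →ₐ[B] A).toRingHom
  let θ : Polynomial B →+* K := Polynomial.eval₂RingHom φ t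
  let : Algebra (Polynomial B) A := e.toAlgebra
  have : IsScalarTower B (Polynomial B) A := IsScalarTower.of_algebraMap_eq fun b => by
    simp [RingHom.algebraMap_toAlgebra, e]
  have : Algebra.IsIntegral (Polynomial B) A := Algebra.IsIntegral.tower_top B
  -- Since `B` is integrally closed, the kernel of `X ↦ f` is generated by the minimal polynomial,
  -- which `θ` kills.
  have hker : Ideal.comap (algebraMap (Polynomial B) A) ⊥ ≤ RingHom.ker θ := by
    intro q hq
    have hq' : Polynomial.aeval f q = 0 := hq
    obtain ⟨r, rfl⟩ := minpoly.isIntegrallyClosed_dvd (Algebra.IsIntegral.isIntegral f) hq'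
    rw [RingHom.mem_ker, map_mul]
    simp [θ, ht]
  have : (RingHom.ker θ).IsPrime := RingHom.ker_isPrime θ
  obtain ⟨Q, -, hQ, hQ'⟩ := Ideal.exists_ideal_over_prime_of_isIntegral (RingHom.ker θ) ⊥ hker
  let j : Polynomial B ⧸ RingHom.ker θ →+* A ⧸ Q := Ideal.quotientMap Q e hQ'.ge
  have hj : Function.Injective j := Ideal.quotientMap_injective' hQ'.le
  let : Algebra (Polynomial B ⧸ RingHom.ker θ) (A ⧸ Q) := j.toAlgebra
  let : Algebra (Polynomial B ⧸ RingHom.ker θ) K := (RingHom.kerLift θ).toAlgebra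
  have : Algebra.IsIntegral (Polynomial B ⧸ RingHom.ker θ) (A ⧸ Q) := by
    constructor
    intro a
    obtain ⟨a, rfl⟩ := Ideal.Quotient.mk_surjective a
    obtain ⟨p, hp, hpa⟩ := Algebra.IsIntegral.isIntegral (R := Polynomial B) a
    refine ⟨p.map (Ideal.Quotient.mk _), hp.map _, ?_⟩
    rw [Polynomial.eval₂_map]
    have : (algebraMap (Polynomial B ⧸ RingHom.ker θ) (A ⧸ Q)).comp
        (Ideal.Quotient.mk (RingHom.ker θ)) = (Ideal.Quotient.mk Q).comp e := rfl
    rw [this, ← Polynomial.hom_eval₂]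
    exact (congrArg _ hpa).trans (map_zero _)
  have : Module.IsTorsionFree (Polynomial B ⧸ RingHom.ker θ) (A ⧸ Q) :=
    Module.isTorsionFree_iff_algebraMap_injective.2 hj
  have : Module.IsTorsionFree (Polynomial B ⧸ RingHom.ker θ) K :=
    Module.isTorsionFree_iff_algebraMap_injective.2 (RingHom.kerLift_injective θ)
  let ψ : (A ⧸ Q) →ₐ[Polynomial B ⧸ RingHom.ker θ] K := IsAlgClosed.lift
  have hψ : ∀ q : Polynomial B, ψ (Ideal.Quotient.mk Q (e q)) = θ q := fun q =>
    ψ.commutes (Ideal.Quotient.mk _ q)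
  refine ⟨(ψ : (A ⧸ Q) →+* K).comp (Ideal.Quotient.mk Q), ?_, ?_⟩
  · ext b
    have := hψ (Polynomial.C b)
    simpa [e, θ] using this
  · have := hψ Polynomial.X
    simpa [e, θ] using this

/-- The roots of a monic polynomial are bounded by the sum of its coefficients. -/
theorem norm_le_of_root {p : Polynomial ℂ} (hp : p.Monic) {t : ℂ} (ht : p.eval t = 0) :
    ‖t‖ ≤ 1 + ∑ i ∈ Finset.range p.natDegree, ‖p.coeff i‖ := by
  by_cases h1 : ‖t‖ ≤ 1
  · exact h1.trans (le_add_of_nonneg_right (Finset.sum_nonneg fun _ _ => norm_nonneg _))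
  push Not at h1
  have h0 : p.natDegree ≠ 0 := by
    intro h
    rw [hp.natDegree_eq_zero] at h
    simp [h] at ht
  obtain ⟨n, hn⟩ := Nat.exists_eq_succ_of_ne_zero h0
  rw [Polynomial.eval_eq_sum_range, Finset.sum_range_succ, hp.coeff_natDegree, one_mul, hn] at ht
  have h2 : ‖t‖ ^ (n + 1) ≤ (∑ i ∈ Finset.range (n + 1), ‖p.coeff i‖) * ‖t‖ ^ n := by
    rw [← norm_pow, eq_neg_of_add_eq_zero_right ht, norm_neg, Finset.sum_mul]
    refine (norm_sum_le _ _).trans (Finset.sum_le_sum fun i hi => ?_)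
    rw [norm_mul, norm_pow]
    gcongr
    · exact h1.le
    · have := Finset.mem_range.1 hi; lia
  rw [pow_succ'] at h2
  have h3 := le_of_mul_le_mul_right h2 (by positivity)
  rw [hn]
  linarith

/-- The kernel of a surjection from a polynomial ring to a domain, contained in the maximal ideal
of an isolated point of its zero set, is that maximal ideal. -/
theorem ker_eq_pointIdeal_of_isolated {σ A : Type} [Fintype σ] [CommRing A] [IsDomain A]
    [Algebra ℂ A] (mk : MvPolynomial σ ℂ →ₐ[ℂ] A) (hmk : Function.Surjective mk) (x : σ → ℂ)
    (hx : ∀ q, mk q = 0 → eval x q = 0) {ε : ℝ} (hε : 0 < ε)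
    (hiso : ∀ z, ‖z - x‖ < ε → (∀ q, mk q = 0 → eval z q = 0) → z = x) :
    RingHom.ker mk = pointIdeal x := by
  classical
  have hft : Algebra.FiniteType ℂ A := Algebra.FiniteType.of_surjective mk hmk
  obtain ⟨d, g, ginj, gint⟩ := exists_integral_inj_algHom_of_fg ℂ A
  let _ : Algebra (MvPolynomial (Fin d) ℂ) A := g.toRingHom.toAlgebra
  have _ : Algebra.IsIntegral (MvPolynomial (Fin d) ℂ) A := ⟨gint⟩
  have _ : Module.IsTorsionFree (MvPolynomial (Fin d) ℂ) A :=
    Module.isTorsionFree_iff_algebraMap_injective.2 ginj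
  rcases Nat.eq_zero_or_pos d with rfl | hd
  -- Dimension zero: a domain integral over a field is a field, so the kernel is already maximal.
  · have hf : IsField A := by
      refine isField_of_isIntegral_of_isField' (R := MvPolynomial (Fin 0) ℂ) ?_
      exact (isEmptyRingEquiv ℂ (Fin 0)).toMulEquiv.isField (Field.toIsField ℂ)
    let _ := hf.toField
    have hmax : (RingHom.ker (mk : MvPolynomial σ ℂ →+* A)).IsMaximal :=
      RingHom.ker_isMaximal_of_surjective _ hmk
    exact hmax.eq_of_le (RingHom.ker_ne_top _) fun q hq => hx q hq
  exfalso
  -- Positive dimension makes punctured neighbourhoods of `π x` nonempty; this is what yields a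
  -- second point near `x`.
  have _ : Nonempty (Fin d) := ⟨⟨0, hd⟩⟩
  choose G hG using fun i => hmk (g (X i))
  let π : (σ → ℂ) → Fin d → ℂ := fun z i => eval z (G i)
  have hπ : Continuous π := continuous_pi fun i => MvPolynomial.continuous_eval _
  let ev : ∀ z : σ → ℂ, (∀ q, mk q = 0 → eval z q = 0) → A →+* ℂ := fun z hz =>
    RingHom.liftOfSurjective (mk : MvPolynomial σ ℂ →+* A) hmk ⟨eval z, fun q hq => hz q hq⟩
  have ev_mk : ∀ z hz q, ev z hz (mk q) = eval z q := fun z hz q =>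
    RingHom.liftOfRightInverse_comp_apply (mk : MvPolynomial σ ℂ →+* A) _ _
      ⟨eval z, fun q hq => hz q hq⟩ q
  have hev : ∀ (z : σ → ℂ) (hz : ∀ q, mk q = 0 → eval z q = 0) (q : MvPolynomial (Fin d) ℂ),
      ev z hz (g q) = eval (π z) q := by
    intro z hz q
    induction q using MvPolynomial.induction_on with
    | C a =>
      rw [← MvPolynomial.algebraMap_eq, g.commutes, MvPolynomial.algebraMap_eq, eval_C]
      rw [← mk.commutes, MvPolynomial.algebraMap_eq, ev_mk, eval_C]
    | add q r hq hr => simp only [map_add, hq, hr]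
    | mul_X q i hq =>
      rw [map_mul, map_mul, map_mul, hq, ← hG, ev_mk, eval_X]
  have hroot : ∀ (z : σ → ℂ), (∀ q, mk q = 0 → eval z q = 0) → ∀ (q : MvPolynomial σ ℂ)
      (c : Polynomial (MvPolynomial (Fin d) ℂ)),
      Polynomial.aeval (mk q) c = 0 →
      (c.map (eval (π z))).eval (eval z q) = 0 := by
    intro z hz q c hc
    have h1 := congrArg (ev z hz) hc
    rw [map_zero, Polynomial.aeval_def, Polynomial.hom_eval₂, ev_mk] at h1
    rw [Polynomial.eval_map, ← h1]
    congr 1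
    exact RingHom.ext fun b => (hev z hz b).symm
  choose c hcm hc using fun j : σ =>
    Algebra.IsIntegral.isIntegral (R := MvPolynomial (Fin d) ℂ) (mk (X j))
  have hcz : ∀ (z : σ → ℂ), (∀ q, mk q = 0 → eval z q = 0) → ∀ j,
      ((c j).map (eval (π z))).eval (z j) = 0 := by
    intro z hz j
    simpa using hroot z hz (X j) (c j) (hc j)
  have hfin : {z : σ → ℂ | (∀ q, mk q = 0 → eval z q = 0) ∧ π z = π x}.Finite := by
    refine (Set.Finite.pi' (t := fun j =>
      {t : ℂ | t ∈ ((c j).map (eval (π x))).roots}) fun j => ?_).subset ?_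
    · exact Multiset.finite_toSet _
    · rintro z ⟨hz, hzx⟩ j
      have := hcz z hz j
      rw [hzx] at this
      exact (Polynomial.mem_roots ((hcm j).map _).ne_zero).2 this
  have hsep : ∀ z : σ → ℂ, ∃ l : MvPolynomial σ ℂ, eval z l = 0 ∧ (z ≠ x → eval x l ≠ 0) := by
    intro z
    by_cases h : z = x
    · exact ⟨0, by simp, fun h' => absurd h h'⟩
    · obtain ⟨j, hj⟩ := Function.ne_iff.1 h
      exact ⟨X j - C (z j), by simp, fun _ => by simpa [sub_eq_zero] using hj.symm⟩
  choose l hl hl' using hsep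
  -- The function `f0` separates `x` from the rest of its finite fibre under `π`: it vanishes at
  -- `x`, and equals `eval x g0 ≠ 0` at every other point.
  let g0 : MvPolynomial σ ℂ := ∏ z ∈ hfin.toFinset.erase x, l z
  let f0 : MvPolynomial σ ℂ := C (eval x g0) - g0
  have hg0 : eval x g0 ≠ 0 := by
    simp only [g0, map_prod]
    exact Finset.prod_ne_zero_iff.2 fun z hz => hl' z (Finset.ne_of_mem_erase hz)
  have hf0x : eval x f0 = 0 := by simp [f0]
  have hf0 : ∀ z, (∀ q, mk q = 0 → eval z q = 0) → π z = π x → eval z f0 = 0 → z = x := by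
    intro z hz hzx h
    by_contra hne
    have : eval z g0 = 0 := by
      simp only [g0, map_prod]
      exact Finset.prod_eq_zero (Finset.mem_erase.2 ⟨hne, hfin.mem_toFinset.2 ⟨hz, hzx⟩⟩) (hl z)
    simp [f0, this, hg0] at h
  set f := mk f0 with hf
  have hχm : (minpoly (MvPolynomial (Fin d) ℂ) f).Monic :=
    minpoly.monic (Algebra.IsIntegral.isIntegral f)
  set χ := minpoly (MvPolynomial (Fin d) ℂ) f with hχ
  have ha0 : eval (π x) (χ.coeff 0) = 0 := by
    have := hroot x hx f0 χ (minpoly.aeval _ f)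
    rw [hf0x, ← Polynomial.coeff_zero_eq_eval_zero, Polynomial.coeff_map] at this
    exact this
  -- A continuous bound for the fibres of `π`: the coordinates of a point over `y` are roots of
  -- monic polynomials whose coefficients depend polynomially on `y`.
  let β : (Fin d → ℂ) → ℝ := fun y =>
    ∑ j, (1 + ∑ i ∈ Finset.range (c j).natDegree, ‖eval y ((c j).coeff i)‖)
  have hβ : Continuous β := continuous_finsetSum _ fun j _ => continuous_const.add
    (continuous_finsetSum _ fun i _ => (MvPolynomial.continuous_eval _).norm)
  have hβ0 : ∀ y j, 0 ≤ 1 + ∑ i ∈ Finset.range (c j).natDegree, ‖eval y ((c j).coeff i)‖ :=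
    fun y j => add_nonneg zero_le_one (Finset.sum_nonneg fun _ _ => norm_nonneg _)
  have hzβ : ∀ z : σ → ℂ, (∀ q, mk q = 0 → eval z q = 0) → ‖z‖ ≤ β (π z) := by
    intro z hz
    refine (pi_norm_le_iff_of_nonneg (Finset.sum_nonneg fun j _ => hβ0 _ j)).2 fun j => ?_
    have := norm_le_of_root ((hcm j).map (eval (π z))) (hcz z hz j)
    rw [(hcm j).natDegree_map] at this
    simp only [Polynomial.coeff_map] at this
    exact this.trans (Finset.single_le_sum (f := fun j => 1 + ∑ i ∈ Finset.range (c j).natDegree,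
      ‖eval (π z) ((c j).coeff i)‖) (fun j _ => hβ0 _ j) (Finset.mem_univ j))
  let K : Set (σ → ℂ) := Metric.closedBall 0 (β (π x) + 1) ∩
    ({z | ∀ q, mk q = 0 → eval z q = 0} ∩ {z | ε ≤ ‖z - x‖})
  have hK : IsCompact K := by
    refine (isCompact_closedBall _ _).inter_right (IsClosed.inter ?_ ?_)
    · simp only [Set.ofPred_forall]
      exact isClosed_iInter fun q => isClosed_iInter fun _ =>
        isClosed_eq (MvPolynomial.continuous_eval _) continuous_const
    · exact isClosed_le continuous_const (by fun_prop)
  -- Only `x` satisfies both `π z = π x` and `f0 z = 0`, so on the compact set of bounded points at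
  -- distance at least `ε` the sum is bounded below by a positive `δ`.
  obtain ⟨δ, hδ, hδK⟩ := hK.exists_forall_le' (f := fun z => ‖π z - π x‖ + ‖eval z f0‖) (a := 0)
    (((hπ.sub continuous_const).norm.add (MvPolynomial.continuous_eval _).norm).continuousOn) (by
      rintro z ⟨-, hz, hzε⟩
      by_contra! h
      have h1 := norm_nonneg (π z - π x)
      have h2 := norm_nonneg (eval z f0)
      have h3 : ‖π z - π x‖ = 0 := by linarith
      have h4 : ‖eval z f0‖ = 0 := by linarith
      have := hf0 z hz (sub_eq_zero.1 (norm_eq_zero.1 h3)) (norm_eq_zero.1 h4)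
      rw [Set.mem_ofPred_eq, this, sub_self, norm_zero] at hzε
      exact absurd hε (not_lt.2 hzε))
  have hy1 : ∀ᶠ y in 𝓝[≠] (π x), β y < β (π x) + 1 :=
    (hβ.continuousAt.eventually_lt_const (lt_add_one _)).filter_mono nhdsWithin_le_nhds
  have hy2 : ∀ᶠ y in 𝓝[≠] (π x), ‖y - π x‖ < δ / 2 :=
    ((continuous_id.sub continuous_const).norm.continuousAt.eventually_lt_const
      (show ‖π x - π x‖ < δ / 2 by rw [sub_self, norm_zero]; exact half_pos hδ)).filter_mono
      nhdsWithin_le_nhds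
  have hy3 : ∀ᶠ y in 𝓝[≠] (π x), ‖eval y (χ.coeff 0)‖ < (δ / 2) ^ χ.natDegree :=
    ((MvPolynomial.continuous_eval _).norm.continuousAt.eventually_lt_const
      (show ‖eval (π x) (χ.coeff 0)‖ < _ by rw [ha0, norm_zero]; positivity)).filter_mono
      nhdsWithin_le_nhds
  obtain ⟨y, ⟨⟨hyβ, hyπ⟩, hyχ⟩, hyx⟩ :=
    (((hy1.and hy2).and hy3).and (eventually_mem_nhdsWithin)).exists
  -- The constant term of `χ` vanishes at `π x`, hence is small at `y`. A small root `t` lifts to a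
  -- point `z` of the variety over `y` with `f0 z = t`. As `z ≠ x`, isolation puts `z` in `K`, where
  -- the sum is at least `δ`, while here it is below `δ / 2 + δ / 2`.
  obtain ⟨t, ht, htδ⟩ := exists_root_norm_lt (hχm.map (eval y)) (half_pos hδ) (by
    rwa [Polynomial.coeff_map, hχm.natDegree_map])
  rw [Polynomial.eval_map] at ht
  obtain ⟨ψ, hψ, hψf⟩ := exists_ringHom_of_root_minpoly (eval y) f t ht
  have hψg : ∀ q, ψ (g q) = eval y q := fun q => RingHom.congr_fun hψ q
  let z : σ → ℂ := fun j => ψ (mk (X j))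
  have hψz : ∀ q, ψ (mk q) = eval z q := by
    intro q
    induction q using MvPolynomial.induction_on with
    | C a =>
      rw [← MvPolynomial.algebraMap_eq, mk.commutes, ← g.commutes, hψg,
        MvPolynomial.algebraMap_eq, MvPolynomial.algebraMap_eq, eval_C, eval_C]
    | add q r hq hr => simp only [map_add, hq, hr]
    | mul_X q i hq => rw [map_mul, map_mul, map_mul, hq, eval_X]
  have hz : ∀ q, mk q = 0 → eval z q = 0 := fun q hq => by rw [← hψz, hq, map_zero]
  have hπz : π z = y := by
    funext i
    change eval z (G i) = y i
    rw [← hψz, hG, hψg, eval_X]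
  have hzx : z ≠ x := by
    rintro rfl
    exact hyx hπz.symm
  have hzK : z ∈ K := by
    refine ⟨?_, hz, ?_⟩
    · rw [mem_closedBall_zero_iff]
      exact (hzβ z hz).trans (hπz ▸ hyβ.le)
    · by_contra h
      exact hzx (hiso z (not_le.1 h) hz)
  have h1 := hδK z hzK
  simp only [hπz, ← hψz] at h1
  rw [← hf, hψf] at h1
  linarith

/-- A prime ideal contained in the maximal ideal of an isolated point of its zero set is that
maximal ideal. -/
theorem eq_pointIdeal_of_isolated {σ : Type} [Fintype σ] (p : Ideal (MvPolynomial σ ℂ))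
    [p.IsPrime] (x : σ → ℂ) (hpx : p ≤ pointIdeal x) {ε : ℝ} (hε : 0 < ε)
    (hiso : ∀ z, ‖z - x‖ < ε → (∀ q ∈ p, eval z q = 0) → z = x) : p = pointIdeal x := by
  have h := ker_eq_pointIdeal_of_isolated (Ideal.Quotient.mkₐ ℂ p)
    (Ideal.Quotient.mkₐ_surjective ℂ p) x
    (fun q hq => hpx (Ideal.Quotient.eq_zero_iff_mem.1 hq)) hε
    (fun z hzx hz => hiso z hzx fun q hq => hz q (Ideal.Quotient.eq_zero_iff_mem.2 hq))
  rw [← h]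
  exact (Ideal.mk_ker (I := p)).symm

/-! ### The multiplicity of an isolated solution -/

section Multiplicity

variable {σ ι : Type} [Fintype σ] {F : ι → MvPolynomial σ ℂ} {x : σ → ℂ}

omit [Fintype σ] in
theorem exists_pow_mem_of_radical {I : Ideal (LocalRingAt x)}
    (h : RingHom.ker (localEval x) ≤ I.radical) {p : MvPolynomial σ ℂ} (hp : eval x p = 0) :
    ∃ k, algebraMap _ (LocalRingAt x) (p ^ k) ∈ I := by
  obtain ⟨k, hk⟩ := h (show localEval x (algebraMap _ _ p) = 0 by simpa using hp)
  exact ⟨k, by simpa using hk⟩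

theorem IsIsolatedSolution.evalSystem_eq_zero (hx : IsIsolatedSolution F x) :
    evalSystem F x = 0 := by
  obtain ⟨ε, -, h⟩ := hx
  have : x ∈ ({x} : Set (σ → ℂ)) := rfl
  rw [← h] at this
  exact this.2

/-- At an isolated solution, every element of the maximal ideal of the local ring is nilpotent
modulo the ideal of the system. -/
theorem IsIsolatedSolution.ker_le_radical (hx : IsIsolatedSolution F x) :
    RingHom.ker (localEval x) ≤ (localIdeal F x).radical := by
  rw [Ideal.radical_eq_sInf]
  refine le_sInf ?_
  rintro q ⟨hFq, hq⟩
  obtain ⟨ε, hε, hiso⟩ := hx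
  -- The radical is an intersection of primes; each contracts to a prime for which `x` is isolated
  -- in the zero set.
  let p := q.comap (algebraMap (MvPolynomial σ ℂ) (LocalRingAt x))
  have hp : p.IsPrime := hq.comap _
  have hle : p ≤ pointIdeal x := by
    intro a ha
    by_contra h
    exact hq.ne_top (Ideal.eq_top_of_isUnit_mem _ ha
      (isUnit_algebraMap_of_eval_ne_zero x fun h' => h h'))
  have hFp : ∀ i, F i ∈ p := fun i => Ideal.mem_comap.2 (hFq (algebraMap_mem_localIdeal x i))
  have hpx : p = pointIdeal x := by
    refine eq_pointIdeal_of_isolated p x hle hε fun z hz hzp => ?_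
    have : z ∈ ({x} : Set (σ → ℂ)) := by
      rw [← hiso]
      exact ⟨hz, funext fun i => hzp (F i) (hFp i)⟩
    exact this
  intro a ha
  obtain ⟨b, s, hs, e⟩ := exists_mul_algebraMap_eq x a
  have hb : b ∈ pointIdeal x := by
    have := congrArg (localEval x) e
    rw [map_mul, RingHom.mem_ker.1 ha, zero_mul, localEval_algebraMap] at this
    exact this.symm
  rw [← hpx] at hb
  have hb' : algebraMap _ (LocalRingAt x) b ∈ q := hb
  rw [← e] at hb'
  exact (Ideal.mul_unit_mem_iff_mem q (isUnit_algebraMap_of_eval_ne_zero x hs)).1 hb'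

/-- The local algebra is Noetherian with residue field `ℂ`, and its maximal ideal is nil. -/
theorem IsIsolatedSolution.finite (hx : IsIsolatedSolution F x) :
    Module.Finite ℂ (LocalRingAt x ⧸ localIdeal F x) := by
  have : IsNoetherianRing (LocalRingAt x) :=
    IsLocalization.isNoetherianRing (pointIdeal x).primeCompl _ inferInstance
  have hF := hx.evalSystem_eq_zero
  refine Module.finite_of_surjective_of_ker_le_nilradical (R := ℂ)
    (S := LocalRingAt x ⧸ localIdeal F x) (T := ℂ) (quotEval x hF) ?_ ?_ ?_
  · intro c
    exact ⟨algebraMap ℂ _ c, (quotEval x hF).commutes c⟩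
  · intro a ha
    obtain ⟨a, rfl⟩ := Ideal.Quotient.mk_surjective a
    obtain ⟨k, hk⟩ := hx.ker_le_radical (show a ∈ RingHom.ker (localEval x) from ha)
    exact ⟨k, by rw [← map_pow]; exact Ideal.Quotient.eq_zero_iff_mem.2 hk⟩
  · exact IsNoetherian.noetherian _

/-- `Module.finrank` is `0` by default in infinite dimension, so positivity rests on finiteness as
well as on nontriviality. -/
theorem IsIsolatedSolution.multiplicity_pos (hx : IsIsolatedSolution F x) :
    0 < multiplicity F x := by
  have := hx.finite
  have := nontrivial_quot x hx.evalSystem_eq_zero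
  exact Module.finrank_pos

/-! ### Regular roots have multiplicity one -/

omit [Fintype σ] in
/-- The ideal of a system is the maximal ideal exactly when the multiplicity is one. -/
theorem multiplicity_eq_one_iff_ker_le (hF : evalSystem F x = 0) :
    multiplicity F x = 1 ↔ RingHom.ker (localEval x) ≤ localIdeal F x := by
  have := nontrivial_quot x hF
  rw [multiplicity]
  constructor
  · intro h a ha
    obtain ⟨c, hc⟩ := (finrank_eq_one_iff_of_nonzero' (1 : LocalRingAt x ⧸ localIdeal F x)
      one_ne_zero).1 h (Ideal.Quotient.mk _ a)
    have h1 := congrArg (quotEval x hF) hc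
    rw [map_smul, map_one, quotEval_mk, show localEval x a = 0 from ha, smul_eq_mul, mul_one] at h1
    rw [h1, zero_smul] at hc
    exact Ideal.Quotient.eq_zero_iff_mem.1 hc.symm
  · intro h
    refine finrank_eq_one_iff'.2 ⟨1, one_ne_zero, fun a => ?_⟩
    obtain ⟨a, rfl⟩ := Ideal.Quotient.mk_surjective a
    refine ⟨localEval x a, ?_⟩
    rw [← Algebra.algebraMap_eq_smul_one, eq_comm, ← sub_eq_zero]
    have : a - algebraMap ℂ _ (localEval x a) ∈ localIdeal F x := h (by
      rw [RingHom.mem_ker, map_sub, AlgHom.commutes]; simp)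
    exact Ideal.Quotient.eq_zero_iff_mem.2 this

end Multiplicity

theorem exists_left_inverse_of_mulVec_injective {α β : Type} [Fintype α] [Fintype β]
    [DecidableEq β] {M : Matrix α β ℂ} (hM : Function.Injective M.mulVec) :
    ∃ L : Matrix β α ℂ, L * M = 1 := by
  classical
  obtain ⟨g, hg⟩ := LinearMap.exists_leftInverse_of_injective M.mulVecLin
    (LinearMap.ker_eq_bot.2 hM)
  refine ⟨LinearMap.toMatrix' g, ?_⟩
  have := congrArg LinearMap.toMatrix' hg
  rwa [LinearMap.toMatrix'_comp, LinearMap.toMatrix'_id, ← Matrix.toLin'_apply',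
    LinearMap.toMatrix'_toLin'] at this

/-! ### Vector fields and the ideal of the system -/

section Derivations

variable {σ ι : Type} [Fintype σ] {F : ι → MvPolynomial σ ℂ} {x : σ → ℂ}

/-- The derivation `∑ vⱼ ∂/∂xⱼ` of the polynomial ring. -/
def vectorField (v : σ → MvPolynomial σ ℂ) :
    Derivation ℂ (MvPolynomial σ ℂ) (MvPolynomial σ ℂ) :=
  ∑ j, v j • pderiv j

theorem vectorField_apply (v : σ → MvPolynomial σ ℂ) (p : MvPolynomial σ ℂ) :
    vectorField v p = ∑ j, v j * pderiv j p := by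
  simp only [vectorField, ← Derivation.coeFnAddMonoidHom_apply, map_sum, Finset.sum_apply]
  rfl

theorem vectorField_X_sub_C (v : σ → MvPolynomial σ ℂ) (j : σ) (c : ℂ) :
    vectorField v (X j - C c) = v j := by
  classical
  rw [vectorField_apply, Finset.sum_eq_single j]
  · simp
  · intro k _ hk
    simp [pderiv_X_of_ne hk.symm]
  · simp

omit [Fintype σ] in
/-- A derivation that maps the generators of an ideal into a larger ideal maps the whole ideal
there. -/
theorem derivation_mem_of_mem_span {D : Derivation ℂ (MvPolynomial σ ℂ) (MvPolynomial σ ℂ)}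
    {J : Ideal (MvPolynomial σ ℂ)} (hF : ∀ i, F i ∈ J) (hD : ∀ i, D (F i) ∈ J)
    {p : MvPolynomial σ ℂ} (hp : p ∈ Ideal.span (Set.range F)) : D p ∈ J := by
  have hle : Ideal.span (Set.range F) ≤ J := Ideal.span_le.2 (by rintro _ ⟨i, rfl⟩; exact hF i)
  induction hp using Submodule.span_induction with
  | mem p hp => obtain ⟨i, rfl⟩ := hp; exact hD i
  | zero => simp
  | add p q _ _ hp hq => rw [map_add]; exact J.add_mem hp hq
  | smul a p hp ih =>
    rw [smul_eq_mul, Derivation.leibniz]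
    exact J.add_mem (J.mul_mem_left _ ih) (J.mul_mem_right _ (hle hp))

/-- A vector field that preserves the local ideal of an isolated solution vanishes there. -/
theorem eval_vectorField_eq_zero (hF : evalSystem F x = 0)
    (hrad : RingHom.ker (localEval x) ≤ (localIdeal F x).radical) {v : σ → MvPolynomial σ ℂ}
    (hv : ∀ i, algebraMap _ (LocalRingAt x) (vectorField v (F i)) ∈ localIdeal F x) (j : σ) :
    eval x (v j) = 0 := by
  classical
  by_contra hj
  let J : Ideal (MvPolynomial σ ℂ) := (localIdeal F x).comap (algebraMap _ (LocalRingAt x))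
  have hmul : ∀ s p : MvPolynomial σ ℂ, eval x s ≠ 0 → s * p ∈ J → p ∈ J := by
    intro s p hs hsp
    rw [Ideal.mem_comap, map_mul] at hsp
    exact (Ideal.unit_mul_mem_iff_mem _ (isUnit_algebraMap_of_eval_ne_zero x hs)).1 hsp
  -- A denominator `s` is a unit at `x`, and `D (s * p) = s * D p + p * D s` with `p ∈ J`, so
  -- invariance passes from the generators to the contracted ideal.
  have hD : ∀ p ∈ J, vectorField v p ∈ J := by
    intro p hp
    obtain ⟨s, hs, hsp⟩ := (algebraMap_mem_map_iff x _ p).1 (Ideal.mem_comap.1 hp)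
    have h1 : vectorField v (s * p) ∈ J := derivation_mem_of_mem_span
      (fun i => Ideal.mem_comap.2 (algebraMap_mem_localIdeal x i))
      (fun i => Ideal.mem_comap.2 (hv i)) hsp
    rw [Derivation.leibniz] at h1
    exact hmul s _ hs ((J.add_mem_iff_left (J.mul_mem_right _ hp)).1 h1)
  have hex : ∃ k, (X j - C (x j) : MvPolynomial σ ℂ) ^ k ∈ J :=
    exists_pow_mem_of_radical hrad (by simp)
  have hk := Nat.find_spec hex
  have hmin := fun k => Nat.find_min hex (m := k)
  cases hn : Nat.find hex with
  | zero =>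
    rw [hn, pow_zero] at hk
    have := localIdeal_le_ker x hF (Ideal.mem_comap.1 hk)
    rw [RingHom.mem_ker, map_one, map_one] at this
    exact one_ne_zero this
  | succ k =>
    rw [hn] at hk
    -- Differentiating the lowest power in `J` gives `(k + 1) v j (X j - C (x j)) ^ k`, whose first
    -- two factors form a unit at `x`; a lower power would then lie in `J`.
    refine hmin k (by lia) (hmul (C ((k + 1 : ℕ) : ℂ) * v j) _ ?_ ?_)
    · rw [map_mul, eval_C]
      exact mul_ne_zero (Nat.cast_ne_zero.2 k.succ_ne_zero) hj
    · have := hD _ hk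
      rw [Derivation.leibniz_pow, vectorField_X_sub_C, Nat.add_sub_cancel] at this
      convert this using 1
      simp only [nsmul_eq_mul, smul_eq_mul, map_natCast]
      ring

end Derivations

/-! ### The Jacobian criterion for multiplicity one -/

section Regular

variable {σ ι : Type} [Fintype σ] {F : ι → MvPolynomial σ ℂ} {x : σ → ℂ}

theorem isRegularAt_iff_injective :
    IsRegularAt F x ↔ Function.Injective (jacobianAt F x).mulVec := by
  have h := LinearMap.finrank_range_add_finrank_ker (jacobianAt F x).mulVecLin
  rw [Module.finrank_fintype_fun_eq_card] at h
  change Module.finrank ℂ (LinearMap.range (jacobianAt F x).mulVecLin) = _ ↔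
    Function.Injective (jacobianAt F x).mulVecLin
  rw [← LinearMap.ker_eq_bot, ← Submodule.finrank_eq_zero]
  lia

/-- A constant vector field `v` in the kernel of `A(x)` maps the ideal of `F` into the maximal ideal
of `x`. Applied to `s * (X j - C (x j))` in that ideal, with `s(x) ≠ 0`, it gives `v j = 0`. -/
theorem isRegularAt_of_ker_le (hF : evalSystem F x = 0)
    (h : RingHom.ker (localEval x) ≤ localIdeal F x) : IsRegularAt F x := by
  rw [isRegularAt_iff_injective]
  refine (injective_iff_map_eq_zero (jacobianAt F x).mulVecLin).2 fun v hv => funext fun j => ?_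
  have h1 : vectorField (fun k => C (v k)) (X j - C (x j)) = C (v j) := vectorField_X_sub_C _ _ _
  obtain ⟨s, hs, hsp⟩ := (algebraMap_mem_map_iff x _ (X j - C (x j))).1
    (h (show localEval x (algebraMap _ _ (X j - C (x j))) = 0 by simp))
  have h2 : vectorField (fun k => C (v k)) (s * (X j - C (x j))) ∈ pointIdeal x := by
    refine derivation_mem_of_mem_span (fun i => congrFun hF i) (fun i => ?_) hsp
    have := congrFun hv i
    simp only [mulVecLin_apply, mulVec, dotProduct, jacobianAt, of_apply, Pi.zero_apply] at this
    rw [RingHom.mem_ker, vectorField_apply, map_sum, ← this]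
    exact Finset.sum_congr rfl fun k _ => by rw [map_mul, eval_C, mul_comm]
  rw [Derivation.leibniz, h1, RingHom.mem_ker] at h2
  simpa [hs] using h2

/-- A left inverse of the Jacobian combines the equations into polynomials that agree with `X j - C
(x j)` to first order. So the ideal generates the maximal ideal modulo its square, and Nakayama's
lemma concludes. -/
theorem IsRegularAt.ker_le [Fintype ι] (hF : evalSystem F x = 0) (h : IsRegularAt F x) :
    RingHom.ker (localEval x) ≤ localIdeal F x := by
  classical
  obtain ⟨L, hL⟩ := exists_left_inverse_of_mulVec_injective (isRegularAt_iff_injective.1 h)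
  have hle : pointIdeal x ≤ Ideal.span (Set.range F) ⊔ pointIdeal x ^ 2 := by
    conv_lhs => rw [pointIdeal_eq_span]
    rw [Ideal.span_le]
    rintro _ ⟨j, rfl⟩
    let g : MvPolynomial σ ℂ := ∑ i, C (L j i) * F i
    have hg : g ∈ Ideal.span (Set.range F) :=
      Ideal.sum_mem _ fun i _ => Ideal.mul_mem_left _ _ (Ideal.subset_span ⟨i, rfl⟩)
    have hgx : eval x g = 0 := by
      simp only [g, map_sum, map_mul]
      exact Finset.sum_eq_zero fun i _ => by rw [show eval x (F i) = 0 from congrFun hF i, mul_zero]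
    have hgd : ∀ k, eval x (pderiv k g) = (1 : Matrix σ σ ℂ) j k := by
      intro k
      rw [← hL, Matrix.mul_apply]
      simp [g, jacobianAt, Derivation.leibniz]
    have h1 := taylor_mem_pointIdeal_sq x g
    simp only [hgx, hgd] at h1
    rw [Finset.sum_eq_single j (by intro k _ hk; simp [Matrix.one_apply_ne hk.symm]) (by simp),
      Matrix.one_apply_eq, map_zero, map_one, sub_zero, one_mul] at h1
    have h2 := Ideal.sub_mem _ (Ideal.mem_sup_left hg)
      (Ideal.mem_sup_right (S := Ideal.span (Set.range F)) h1)
    simpa using h2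
  have hle' := Ideal.map_mono (f := algebraMap _ (LocalRingAt x)) hle
  rw [Ideal.map_sup, Ideal.map_pow, Localization.AtPrime.map_eq_maximalIdeal, pow_two] at hle'
  have : IsNoetherianRing (LocalRingAt x) :=
    IsLocalization.isNoetherianRing (pointIdeal x).primeCompl _ inferInstance
  rw [← maximalIdeal_eq_ker]
  exact Submodule.le_of_le_smul_of_le_jacobson_bot (IsNoetherian.noetherian _)
    (IsLocalRing.jacobson_eq_maximalIdeal _ bot_ne_top).ge hle'

theorem multiplicity_eq_one_iff [Fintype ι] (hF : evalSystem F x = 0) :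
    multiplicity F x = 1 ↔ IsRegularAt F x :=
  (multiplicity_eq_one_iff_ker_le hF).trans
    ⟨isRegularAt_of_ker_le hF, IsRegularAt.ker_le hF⟩

end Regular

/-! ### Deflation lowers the multiplicity -/

section Drop

variable {σ ι : Type} [Fintype σ] {F : ι → MvPolynomial σ ℂ} {x : σ → ℂ} {s : ℕ}
  {B : Matrix σ (Fin s) ℂ} {h : Fin s → ℂ} {l : Fin s → ℂ}

theorem evalSystem_deflate_eq_zero_iff :
    evalSystem (deflate F B h) (Sum.elim x l) = 0 ↔
      evalSystem F x = 0 ∧ (jacobianAt F x * B) *ᵥ l = 0 ∧ h ⬝ᵥ l = 1 := by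
  have e : ∀ p : MvPolynomial σ ℂ, eval (Sum.elim x l) (rename Sum.inl p) = eval x p := by
    intro p; rw [eval_rename, Sum.elim_comp_inl]
  simp only [funext_iff, Sum.forall, evalSystem, deflate, Sum.elim_inl, Sum.elim_inr, e,
    Pi.zero_apply, map_sum, map_mul, map_sub, map_one, eval_C, eval_X, sub_eq_zero, mulVec,
    dotProduct, Matrix.mul_apply, jacobianAt, of_apply, forall_const]

theorem IsMultiplier.isIsolatedSolution (hl : IsMultiplier F x B h l)
    (hx : IsIsolatedSolution F x) :
    IsIsolatedSolution (deflate F B h) (Sum.elim x l) := by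
  obtain ⟨ε, hε, hiso⟩ := hx
  refine ⟨ε, hε, Set.eq_singleton_iff_unique_mem.2 ⟨⟨by simpa using hε, (hl l).2 rfl⟩, ?_⟩⟩
  rintro w ⟨hw, hw0⟩
  obtain ⟨y, m, rfl⟩ : ∃ y m, w = Sum.elim y m := ⟨_, _, (Sum.elim_comp_inl_inr w).symm⟩
  have hy : y ∈ ({x} : Set (σ → ℂ)) := by
    rw [← hiso]
    refine ⟨show ‖y - x‖ < ε from lt_of_le_of_lt ?_ hw, (evalSystem_deflate_eq_zero_iff.1 hw0).1⟩
    refine (pi_norm_le_iff_of_nonneg (norm_nonneg _)).2 fun j => ?_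
    exact norm_le_pi_norm (Sum.elim y m - Sum.elim x l) (Sum.inl j)
  rw [Set.mem_singleton_iff] at hy
  subst hy
  rw [(hl m).1 hw0]

/-- The matrix over the polynomial ring that stacks `A(x) B` and the row `h`. -/
def deflationMatrix (F : ι → MvPolynomial σ ℂ) (B : Matrix σ (Fin s) ℂ) (h : Fin s → ℂ) :
    Matrix (ι ⊕ Unit) (Fin s) (MvPolynomial σ ℂ) :=
  Matrix.of (Sum.elim (fun i k => ∑ j, pderiv j (F i) * C (B j k)) fun _ k => C (h k))

theorem deflationMatrix_map_eval : (deflationMatrix F B h).map (eval x) =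
    Matrix.of (Sum.elim (jacobianAt F x * B) fun _ => h) := by
  ext (i | i) k
  · change eval x (∑ j, pderiv j (F i) * C (B j k)) = (jacobianAt F x * B) i k
    simp [Matrix.mul_apply, jacobianAt]
  · exact eval_C (h k)

/-- A kernel vector could be added to `l`, against uniqueness. -/
theorem IsMultiplier.mulVec_injective (hl : IsMultiplier F x B h l) :
    Function.Injective ((deflationMatrix F B h).map (eval x)).mulVec := by
  refine (injective_iff_map_eq_zero ((deflationMatrix F B h).map (eval x)).mulVecLin).2
    fun m hm => ?_
  rw [deflationMatrix_map_eval, mulVecLin_apply] at hm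
  have h0 := evalSystem_deflate_eq_zero_iff.1 ((hl l).2 rfl)
  have h1 : (jacobianAt F x * B) *ᵥ m = 0 := funext fun i => congrFun hm (Sum.inl i)
  have h2 : h ⬝ᵥ m = 0 := congrFun hm (Sum.inr ())
  have := (hl (l + m)).1 (evalSystem_deflate_eq_zero_iff.2
    ⟨h0.1, by rw [mulVec_add, h0.2.1, h1, add_zero], by rw [dotProduct_add, h0.2.2, h2, add_zero]⟩)
  simpa using this

/-- The local algebra of the deflated system. -/
def DeflatedAlgebra (F : ι → MvPolynomial σ ℂ) (x : σ → ℂ) (B : Matrix σ (Fin s) ℂ)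
    (h l : Fin s → ℂ) : Type :=
  LocalRingAt (Sum.elim x l : σ ⊕ Fin s → ℂ) ⧸ localIdeal (deflate F B h) (Sum.elim x l)

instance : CommRing (DeflatedAlgebra F x B h l) :=
  inferInstanceAs (CommRing (LocalRingAt (Sum.elim x l : σ ⊕ Fin s → ℂ) ⧸
    localIdeal (deflate F B h) (Sum.elim x l)))

instance : Algebra ℂ (DeflatedAlgebra F x B h l) :=
  inferInstanceAs (Algebra ℂ (LocalRingAt (Sum.elim x l : σ ⊕ Fin s → ℂ) ⧸
    localIdeal (deflate F B h) (Sum.elim x l)))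

variable (F x B h l) in
/-- The quotient map onto the local algebra of the deflated system. -/
def deflatedQuot : LocalRingAt (Sum.elim x l : σ ⊕ Fin s → ℂ) →ₐ[ℂ] DeflatedAlgebra F x B h l :=
  Ideal.Quotient.mkₐ ℂ (localIdeal (deflate F B h) (Sum.elim x l))

theorem deflatedQuot_surjective : Function.Surjective (deflatedQuot F x B h l) :=
  Ideal.Quotient.mk_surjective

variable (F x B h l) in
/-- The class of a polynomial in the local algebra of the deflated system. -/
def deflatedMk : MvPolynomial (σ ⊕ Fin s) ℂ →ₐ[ℂ] DeflatedAlgebra F x B h l :=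
  (deflatedQuot F x B h l).comp
    (IsScalarTower.toAlgHom ℂ (MvPolynomial (σ ⊕ Fin s) ℂ) (LocalRingAt (Sum.elim x l)))

theorem deflatedQuot_algebraMap (p : MvPolynomial (σ ⊕ Fin s) ℂ) :
    deflatedQuot F x B h l (algebraMap _ _ p) = deflatedMk F x B h l p := rfl

/-- Evaluation at `(x, l)` on the local algebra of the deflated system. -/
def deflatedEval (hz : evalSystem (deflate F B h) (Sum.elim x l) = 0) :
    DeflatedAlgebra F x B h l →ₐ[ℂ] ℂ :=
  quotEval (Sum.elim x l) hz

theorem deflatedEval_mk (hz : evalSystem (deflate F B h) (Sum.elim x l) = 0)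
    (p : MvPolynomial (σ ⊕ Fin s) ℂ) :
    deflatedEval hz (deflatedMk F x B h l p) = eval (Sum.elim x l) p :=
  localEval_algebraMap (Sum.elim x l) p

theorem deflatedMk_deflate (a : ι ⊕ (ι ⊕ Unit)) :
    deflatedMk F x B h l (deflate F B h a) = 0 :=
  Ideal.Quotient.eq_zero_iff_mem.2 (algebraMap_mem_localIdeal _ a)

theorem isUnit_deflatedMk {p : MvPolynomial (σ ⊕ Fin s) ℂ} (hp : eval (Sum.elim x l) p ≠ 0) :
    IsUnit (deflatedMk F x B h l p) :=
  (isUnit_algebraMap_of_eval_ne_zero _ hp).map (deflatedQuot F x B h l)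

theorem isUnit_deflatedMk_rename (q : MvPolynomial σ ℂ) (hq : eval x q ≠ 0) :
    IsUnit (((deflatedMk F x B h l).comp (rename Sum.inl)) q) := by
  refine isUnit_deflatedMk (p := rename Sum.inl q) ?_
  rwa [eval_rename, Sum.elim_comp_inl]

variable (F x B h l) in
/-- The map from the local ring at `x` to the local algebra of the deflated system. -/
def toDeflated : LocalRingAt x →ₐ[ℂ] DeflatedAlgebra F x B h l :=
  localLift x ((deflatedMk F x B h l).comp (rename Sum.inl)) isUnit_deflatedMk_rename

@[simp] theorem toDeflated_algebraMap (p : MvPolynomial σ ℂ) :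
    toDeflated F x B h l (algebraMap _ _ p) = deflatedMk F x B h l (rename Sum.inl p) :=
  localLift_algebraMap x _ _ p

theorem toDeflated_eq_zero_of_mem {a : LocalRingAt x} (ha : a ∈ localIdeal F x) :
    toDeflated F x B h l a = 0 := by
  have : localIdeal F x ≤ RingHom.ker (toDeflated F x B h l) := by
    rw [Ideal.map_le_iff_le_comap, Ideal.span_le]
    rintro _ ⟨i, rfl⟩
    exact (toDeflated_algebraMap (F i)).trans (deflatedMk_deflate (Sum.inl i))
  exact this ha

theorem deflatedEval_toDeflated (hz : evalSystem (deflate F B h) (Sum.elim x l) = 0)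
    (a : LocalRingAt x) : deflatedEval hz (toDeflated F x B h l a) = localEval x a := by
  obtain ⟨p, q, hq, e⟩ := exists_mul_algebraMap_eq x a
  have key : ∀ r : MvPolynomial σ ℂ,
      deflatedEval hz (deflatedMk F x B h l (rename Sum.inl r)) = eval x r := by
    intro r
    rw [deflatedEval_mk, eval_rename, Sum.elim_comp_inl]
  have h1 := congrArg (fun t => deflatedEval hz (toDeflated F x B h l t)) e
  have h2 := congrArg (localEval x) e
  simp only [map_mul, toDeflated_algebraMap, key, localEval_algebraMap] at h1 h2
  exact mul_right_cancel₀ hq (h1.trans h2.symm)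

theorem sum_deflationMatrix_mul (a : ι ⊕ Unit) :
    ∑ k, deflatedMk F x B h l (rename Sum.inl (deflationMatrix F B h a k)) *
      deflatedMk F x B h l (X (Sum.inr k)) = Sum.elim (fun _ => 0) (fun _ => 1) a := by
  rcases a with i | i
  · have := deflatedMk_deflate (F := F) (x := x) (B := B) (h := h) (l := l) (Sum.inr (Sum.inl i))
    simpa [deflate, deflationMatrix, map_sum, map_mul] using this
  · have := deflatedMk_deflate (F := F) (x := x) (B := B) (h := h) (l := l) (Sum.inr (Sum.inr i))
    simpa [deflate, deflationMatrix, map_sum, map_mul, sub_eq_zero] using this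

/-- In the local algebra of the deflated system the multipliers are fractions in the original
unknowns, by Cramer's rule. -/
theorem IsMultiplier.exists_fraction [Fintype ι] (hl : IsMultiplier F x B h l) :
    ∃ (q : MvPolynomial σ ℂ) (u : Fin s → MvPolynomial σ ℂ), eval x q ≠ 0 ∧
      ∀ k, deflatedMk F x B h l (rename Sum.inl q) * deflatedMk F x B h l (X (Sum.inr k)) =
        deflatedMk F x B h l (rename Sum.inl (u k)) := by
  classical
  obtain ⟨L, hL⟩ := exists_left_inverse_of_mulVec_injective hl.mulVec_injective
  -- `L` inverts the stacked matrix at `x` only, so `T` is square with `T(x) = 1`, and `q = det T`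
  -- is `1` at `x`. The deflated equations say that the stacked matrix maps the multipliers to `(0,
  -- 1)`; apply `adj(T) L`.
  let T : Matrix (Fin s) (Fin s) (MvPolynomial σ ℂ) := L.map C * deflationMatrix F B h
  have hT : ∀ {R : Type} [Semiring R] (f : MvPolynomial σ ℂ →+* R),
      T.map f = (L.map C).map f * (deflationMatrix F B h).map f := fun f => Matrix.map_mul
  refine ⟨T.det, fun k => ∑ k', T.adjugate k k' * C (L k' (Sum.inr ())), ?_, fun k => ?_⟩
  · have : (eval x).mapMatrix T = 1 := by
      rw [← hL, RingHom.mapMatrix_apply, hT]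
      congr 1
      ext k k'
      simp
    rw [RingHom.map_det, this, det_one]
    exact one_ne_zero
  · let φ : MvPolynomial σ ℂ →+* DeflatedAlgebra F x B h l :=
      ((deflatedMk F x B h l).comp (rename Sum.inl)).toRingHom
    let lam : Fin s → DeflatedAlgebra F x B h l := fun k => deflatedMk F x B h l (X (Sum.inr k))
    have h1 : (deflationMatrix F B h).map φ *ᵥ lam = Sum.elim (fun _ => 0) (fun _ => 1) :=
      funext fun a => sum_deflationMatrix_mul a
    have h2 : (T.map φ) *ᵥ lam = fun k => φ (C (L k (Sum.inr ()))) := by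
      rw [hT, ← mulVec_mulVec, h1]
      funext k
      simp only [mulVec, dotProduct, map_apply, Fintype.sum_sum_type, Sum.elim_inl, Sum.elim_inr,
        mul_zero, mul_one, Finset.sum_const_zero, zero_add, Finset.univ_unique, Finset.sum_singleton]
    have h3 : (T.adjugate * T).map φ *ᵥ lam = T.adjugate.map φ *ᵥ
        fun k => φ (C (L k (Sum.inr ()))) := by
      rw [Matrix.map_mul, ← mulVec_mulVec, h2]
    have h4 := congrFun h3 k
    have h5 : ((T.adjugate * T).map φ *ᵥ lam) k = φ T.det * lam k := by
      rw [adjugate_mul]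
      simp [mulVec, dotProduct, Matrix.one_apply, ite_mul, apply_ite φ]
    rw [h5] at h4
    refine h4.trans ?_
    simp only [mulVec, dotProduct, map_apply, ← map_mul, ← map_sum]
    rfl

/-- The image contains the old unknowns and, by Cramer's rule, the multipliers. Denominators cause
no trouble: a preimage of an element nonzero at `(x, l)` is nonzero at `x`, hence a unit. -/
theorem IsMultiplier.toDeflated_surjective [Fintype ι] (hl : IsMultiplier F x B h l) :
    Function.Surjective (toDeflated F x B h l) := by
  have hz := (hl l).2 rfl
  obtain ⟨q, u, hq, hu⟩ := hl.exists_fraction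
  have hpoly : ∀ p, deflatedMk F x B h l p ∈ (toDeflated F x B h l).range := by
    intro p
    induction p using MvPolynomial.induction_on with
    | C a => exact ⟨algebraMap ℂ _ a, by
        rw [← MvPolynomial.algebraMap_eq]
        exact ((toDeflated F x B h l).commutes a).trans ((deflatedMk F x B h l).commutes a).symm⟩
    | add p q hp hq => rw [map_add]; exact add_mem hp hq
    | mul_X p j hp =>
      rw [map_mul]
      refine mul_mem hp ?_
      rcases j with j | k
      · exact ⟨algebraMap _ _ (X j), (toDeflated_algebraMap (X j)).trans (by rw [rename_X])⟩
      · obtain ⟨w, hw⟩ := (isUnit_algebraMap_of_eval_ne_zero x hq).exists_left_inv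
        refine ⟨w * algebraMap _ _ (u k), ?_⟩
        change toDeflated F x B h l _ = _
        rw [map_mul, toDeflated_algebraMap, ← hu, ← mul_assoc,
          ← toDeflated_algebraMap, ← map_mul, hw, map_one, one_mul]
  intro a
  obtain ⟨a, rfl⟩ := deflatedQuot_surjective a
  obtain ⟨p, r, hr, e⟩ := exists_mul_algebraMap_eq _ a
  obtain ⟨b, hb⟩ := hpoly p
  obtain ⟨c, hc⟩ := hpoly r
  have hcu : IsUnit c := by
    rw [isUnit_iff_localEval_ne_zero, ← deflatedEval_toDeflated hz]
    have : deflatedEval hz (toDeflated F x B h l c) = eval (Sum.elim x l) r :=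
      (congrArg (deflatedEval hz) hc).trans (deflatedEval_mk hz r)
    rwa [this]
  obtain ⟨w, hw⟩ := hcu.exists_right_inv
  refine ⟨b * w, ?_⟩
  have e' := congrArg (deflatedQuot F x B h l) e
  rw [map_mul, deflatedQuot_algebraMap, deflatedQuot_algebraMap] at e'
  change toDeflated F x B h l b = _ at hb
  change toDeflated F x B h l c = _ at hc
  rw [map_mul, hb, ← e', ← hc, mul_assoc, ← map_mul, hw, map_one, mul_one]

/-- Equal dimensions would make the surjection of local algebras injective, and the vector field `B
u` would preserve the local ideal of `F` without vanishing at `x`. -/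
theorem IsMultiplier.multiplicity_lt [Fintype ι] (hl : IsMultiplier F x B h l)
    (hx : IsIsolatedSolution F x) (hBl : B *ᵥ l ≠ 0) :
    multiplicity (deflate F B h) (Sum.elim x l) < multiplicity F x := by
  have hz := (hl l).2 rfl
  have _ := hx.finite
  let φ : (LocalRingAt x ⧸ localIdeal F x) →ₐ[ℂ] DeflatedAlgebra F x B h l :=
    Ideal.Quotient.liftₐ _ (toDeflated F x B h l) fun _ => toDeflated_eq_zero_of_mem
  have hφ : Function.Surjective φ := fun b => by
    obtain ⟨a, rfl⟩ := hl.toDeflated_surjective b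
    exact ⟨Ideal.Quotient.mk _ a, rfl⟩
  have hle : multiplicity (deflate F B h) (Sum.elim x l) ≤ multiplicity F x :=
    φ.toLinearMap.finrank_le_finrank_of_surjective hφ
  refine lt_of_le_of_ne hle fun heq => hBl ?_
  have hinj : Function.Injective φ := by
    have _ : Module.Finite ℂ (DeflatedAlgebra F x B h l) :=
      Module.Finite.of_surjective φ.toLinearMap hφ
    have heq' : Module.finrank ℂ (LocalRingAt x ⧸ localIdeal F x) =
      Module.finrank ℂ (DeflatedAlgebra F x B h l) := heq.symm
    exact (LinearMap.injective_iff_surjective_of_finrank_eq_finrank (f := φ.toLinearMap)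
      heq').2 hφ
  have hker : ∀ a, toDeflated F x B h l a = 0 → a ∈ localIdeal F x := fun a ha =>
    Ideal.Quotient.eq_zero_iff_mem.1 (hinj (a₁ := Ideal.Quotient.mk _ a)
      (ha.trans (map_zero φ).symm))
  obtain ⟨q, u, hq, hu⟩ := hl.exists_fraction
  have hux : ∀ k, eval x (u k) = eval x q * l k := by
    intro k
    have h1 := congrArg (deflatedEval hz) (hu k)
    rw [map_mul, ← toDeflated_algebraMap, ← toDeflated_algebraMap, deflatedEval_toDeflated,
      deflatedEval_toDeflated, localEval_algebraMap, localEval_algebraMap] at h1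
    have h2 : deflatedEval hz (deflatedMk F x B h l (X (Sum.inr k))) = l k :=
      (deflatedEval_mk hz (X (Sum.inr k))).trans (by simp)
    rw [← h1, h2]
  have hv := eval_vectorField_eq_zero (v := fun j => ∑ k, C (B j k) * u k)
    hx.evalSystem_eq_zero hx.ker_le_radical (fun i => hker _ ?_)
  · funext j
    have := hv j
    simp only [map_sum, map_mul, eval_C, hux] at this
    have h2 : eval x q * (B *ᵥ l) j = 0 := by
      rw [← this, mulVec, dotProduct, Finset.mul_sum]
      exact Finset.sum_congr rfl fun k _ => by ring
    exact (mul_eq_zero.1 h2).resolve_left hq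
  -- In the deflated algebra `u = q λ`, so this derivative becomes `q` times the equation `A B λ =
  -- 0`; injectivity brings it back to the local ideal of `F`.
  · have h1 : vectorField (fun j => ∑ k, C (B j k) * u k) (F i) =
        ∑ k, deflationMatrix F B h (Sum.inl i) k * u k := by
      simp only [vectorField_apply, deflationMatrix, of_apply, Sum.elim_inl, Finset.sum_mul]
      rw [Finset.sum_comm]
      exact Finset.sum_congr rfl fun k _ => Finset.sum_congr rfl fun j _ => by ring
    have h2 := sum_deflationMatrix_mul (F := F) (x := x) (B := B) (h := h) (l := l) (Sum.inl i)
    have h3 := congrArg (deflatedMk F x B h l (rename Sum.inl q) * ·) h2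
    simp only [Finset.mul_sum, Sum.elim_inl, mul_zero] at h3
    rw [h1, toDeflated_algebraMap, ← h3, map_sum, map_sum]
    refine Finset.sum_congr rfl fun k _ => ?_
    rw [map_mul, map_mul, ← hu]
    ring

end Drop

/-! ### Random matrices -/

/-- A matrix of polynomials that has full column rank at one point has full column rank at a
generic point. -/
theorem exists_ne_zero_of_mulVec_injective {τ α β : Type} [Fintype α] [Fintype β]
    (M : Matrix α β (MvPolynomial τ ℂ)) {p₀ : τ → ℂ}
    (h₀ : Function.Injective (M.map (eval p₀)).mulVec) :
    ∃ Q : MvPolynomial τ ℂ, Q ≠ 0 ∧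
      ∀ p, eval p Q ≠ 0 → Function.Injective (M.map (eval p)).mulVec := by
  classical
  obtain ⟨L, hL⟩ := exists_left_inverse_of_mulVec_injective h₀
  let T : Matrix β β (MvPolynomial τ ℂ) := (L.map C : Matrix β α (MvPolynomial τ ℂ)) * M
  have hQ : ∀ p : τ → ℂ, eval p T.det = (L * M.map (eval p)).det := by
    intro p
    rw [RingHom.map_det, RingHom.mapMatrix_apply, show T.map (eval p) = _ from Matrix.map_mul]
    congr 2
    ext i j
    simp
  -- The determinant of `L * M` is `1` at `p₀`, and wherever it is nonzero `M` has a trivial kernel.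
  refine ⟨T.det, fun h => ?_, fun p hp => ?_⟩
  · have := hQ p₀
    rw [h, hL, det_one, map_zero] at this
    exact zero_ne_one this
  · rw [hQ] at hp
    have h1 := mulVec_injective_iff_isUnit.2 ((isUnit_iff_isUnit_det _).2 (isUnit_iff_ne_zero.2 hp))
    intro v w hvw
    apply h1
    simp only [← mulVec_mulVec]
    exact congrArg (L *ᵥ ·) hvw

section Generic

variable {σ ι : Type} [Fintype σ] {F : ι → MvPolynomial σ ℂ} {x : σ → ℂ}

/-- For a matrix `A` of rank `r` without full column rank there are vectors `h` and injective
matrices `B` with `r + 1` columns such that `A B` stacked on `h` is injective. -/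
theorem exists_injective_of_rank_lt (A : Matrix ι σ ℂ) (hA : ¬ Function.Injective A.mulVec) :
    ∃ (B : Matrix σ (Fin (A.rank + 1)) ℂ) (h : Fin (A.rank + 1) → ℂ),
      Function.Injective B.mulVec ∧ ∀ c, (A * B) *ᵥ c = 0 → h ⬝ᵥ c = 0 → c = 0 := by
  classical
  obtain ⟨b₀, hb₀, hb₀'⟩ : ∃ b₀, A *ᵥ b₀ = 0 ∧ b₀ ≠ 0 := by
    by_contra! hc
    exact hA ((injective_iff_map_eq_zero A.mulVecLin).2 hc)
  let e := Module.finBasisOfFinrankEq ℂ (LinearMap.range A.mulVecLin) (n := A.rank) rfl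
  choose b hb using fun i => (e i).2
  -- The columns are a kernel vector of `A` and preimages of a basis of its range. The kernel of `A
  -- * B` is then the first coordinate axis, which `h = Pi.single 0 1` detects.
  let B : Matrix σ (Fin (A.rank + 1)) ℂ := Matrix.of fun j k => (Fin.cons b₀ b : Fin _ → σ → ℂ) k j
  have hB : ∀ c, B *ᵥ c = c 0 • b₀ + ∑ i : Fin A.rank, c i.succ • b i := by
    intro c
    funext j
    simp only [mulVec, dotProduct, B, of_apply, Fin.sum_univ_succ, Fin.cons_zero, Fin.cons_succ,
      Pi.add_apply, Finset.sum_apply, Pi.smul_apply, smul_eq_mul, mul_comm]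
  have hAB : ∀ c, (A * B) *ᵥ c = 0 → ∀ i : Fin A.rank, c i.succ = 0 := by
    intro c hc
    have h1 : ∑ i, c (Fin.succ i) • e i = 0 := by
      apply Subtype.ext
      rw [← mulVec_mulVec, hB, mulVec_add, mulVec_smul, hb₀, smul_zero, zero_add,
        ← mulVecLin_apply, map_sum] at hc
      rw [AddSubmonoidClass.coe_finsetSum]
      simpa [hb] using hc
    exact Fintype.linearIndependent_iff.1 e.linearIndependent _ h1
  refine ⟨B, Pi.single 0 1, (injective_iff_map_eq_zero B.mulVecLin).2 fun c hc => ?_,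
    fun c hc hc0 => ?_⟩
  · rw [mulVecLin_apply] at hc
    have h1 := hAB c (by rw [← mulVec_mulVec, hc, mulVec_zero])
    rw [hB, Finset.sum_eq_zero fun i _ => by rw [h1, zero_smul], add_zero] at hc
    have h2 := (smul_eq_zero.1 hc).resolve_right hb₀'
    exact funext fun k => Fin.cases h2 h1 k
  · rw [single_one_dotProduct] at hc0
    exact funext fun k => Fin.cases hc0 (hAB c hc) k

theorem isMultiplier_of_injective {s : ℕ} {B : Matrix σ (Fin s) ℂ} {h l : Fin s → ℂ}
    {A : Matrix ι σ ℂ} (hF : evalSystem F x = 0) (hA : jacobianAt F x = A)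
    (hinj : ∀ c, (A * B) *ᵥ c = 0 → h ⬝ᵥ c = 0 → c = 0)
    (hl : (A * B) *ᵥ l = 0) (hl1 : h ⬝ᵥ l = 1) : IsMultiplier F x B h l := by
  subst hA
  intro l'
  rw [evalSystem_deflate_eq_zero_iff]
  constructor
  · rintro ⟨-, h1, h2⟩
    refine sub_eq_zero.1 (hinj _ ?_ ?_)
    · rw [mulVec_sub, h1, hl, sub_zero]
    · rw [dotProduct_sub, h2, hl1, sub_self]
  · rintro rfl
    exact ⟨hF, hl, hl1⟩

/-- At a singular solution, random `B` and `h` determine the multipliers. -/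
theorem forGeneric_isMultiplier [Fintype ι] (hF : evalSystem F x = 0) (hx : ¬ IsRegularAt F x) :
    ForGeneric fun (B : Matrix σ (Fin ((jacobianAt F x).rank + 1)) ℂ)
      (h : Fin ((jacobianAt F x).rank + 1) → ℂ) => ∃ l, IsMultiplier F x B h l ∧ B *ᵥ l ≠ 0 := by
  classical
  rw [isRegularAt_iff_injective] at hx
  generalize hA : jacobianAt F x = A at hx ⊢
  obtain ⟨B₀, h₀, hB₀, hh₀⟩ := exists_injective_of_rank_lt A hx
  let s := A.rank + 1
  -- Universal matrices with indeterminate entries; they specialize to `B` and to `A * B` stacked on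
  -- `h`.
  let M₁ : Matrix σ (Fin s) (MvPolynomial ((σ × Fin s) ⊕ Fin s) ℂ) :=
    Matrix.of fun j k => X (Sum.inl (j, k))
  let A' : Matrix ι σ (MvPolynomial ((σ × Fin s) ⊕ Fin s) ℂ) := A.map C
  let M₂ : Matrix (ι ⊕ Unit) (Fin s) (MvPolynomial ((σ × Fin s) ⊕ Fin s) ℂ) :=
    Matrix.of (Sum.elim (A' * M₁) fun _ k => X (Sum.inr k))
  have e₁ : ∀ (B : Matrix σ (Fin s) ℂ) (h : Fin s → ℂ),
      M₁.map (eval (Sum.elim (fun jk => B jk.1 jk.2) h)) = B := by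
    intro B h
    ext j k
    exact eval_X _
  have e₂ : ∀ (B : Matrix σ (Fin s) ℂ) (h : Fin s → ℂ),
      M₂.map (eval (Sum.elim (fun jk => B jk.1 jk.2) h)) =
        Matrix.of (Sum.elim (A * B) fun _ => h) := by
    intro B h
    ext (i | i) k
    · change eval _ ((A' * M₁) i k) = (A * B) i k
      conv_rhs => rw [← e₁ B h]
      simp [A', Matrix.mul_apply]
    · exact eval_X _
  obtain ⟨Q₁, hQ₁, hQ₁'⟩ := exists_ne_zero_of_mulVec_injective M₁
    (p₀ := Sum.elim (fun jk => B₀ jk.1 jk.2) h₀) (by rw [e₁]; exact hB₀)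
  obtain ⟨Q₂, hQ₂, hQ₂'⟩ := exists_ne_zero_of_mulVec_injective M₂
    (p₀ := Sum.elim (fun jk => B₀ jk.1 jk.2) h₀) (by
      rw [e₂]
      refine (injective_iff_map_eq_zero (mulVecLin _)).2 fun c hc => ?_
      exact hh₀ c (funext fun i => congrFun hc (Sum.inl i)) (congrFun hc (Sum.inr ())))
  refine ⟨Q₁ * Q₂, mul_ne_zero hQ₁ hQ₂, fun B h hQ => ?_⟩
  rw [map_mul] at hQ
  have hB := hQ₁' _ (left_ne_zero_of_mul hQ)
  have hh := hQ₂' _ (right_ne_zero_of_mul hQ)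
  rw [e₁] at hB
  rw [e₂] at hh
  have hinj : ∀ c, (A * B) *ᵥ c = 0 → h ⬝ᵥ c = 0 → c = 0 := by
    intro c hc hc'
    refine hh ((funext fun a => ?_ : _ = (0 : ι ⊕ Unit → ℂ)).trans (mulVec_zero _).symm)
    rcases a with i | i
    · exact congrFun hc i
    · exact hc'
  obtain ⟨c, hc, hc0⟩ : ∃ c, (A * B) *ᵥ c = 0 ∧ c ≠ 0 := by
    by_contra! hcon
    have hker : LinearMap.ker (A * B).mulVecLin = ⊥ :=
      LinearMap.ker_eq_bot.2 ((injective_iff_map_eq_zero (A * B).mulVecLin).2 hcon)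
    have h1 := LinearMap.finrank_range_add_finrank_ker (A * B).mulVecLin
    rw [hker, finrank_bot, Module.finrank_fintype_fun_eq_card, Fintype.card_fin] at h1
    have h2 : (A * B).rank ≤ A.rank := rank_mul_le_left A B
    rw [Matrix.rank] at h2
    lia
  have hd : h ⬝ᵥ c ≠ 0 := fun h0 => hc0 (hinj c hc h0)
  refine ⟨(h ⬝ᵥ c)⁻¹ • c, isMultiplier_of_injective hF hA hinj ?_ ?_, fun h0 => ?_⟩
  · rw [mulVec_smul, hc, smul_zero]
  · rw [dotProduct_smul, smul_eq_mul, inv_mul_cancel₀ hd]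
  · have := hB (h0.trans (mulVec_zero B).symm)
    exact hc0 ((smul_eq_zero.1 this).resolve_left (inv_ne_zero hd))

end Generic

/-! ### Newton's method at a regular root -/

/-- Within `1 / (2 * c)` of `x` each step at least halves the error, so errors and corrections are
comparable: the error is at most twice the correction. This gives `3/2 * c * 4 = 6 * c` for the
corrections, and `8 * c` leaves room. -/
theorem quadratic_convergence {E : Type} [NormedAddCommGroup E] {N : E → E} {x : E}
    (hN : (fun u => N u - x) =O[𝓝 x] fun u => ‖u - x‖ ^ 2) :
    ∃ ε : ℝ, 0 < ε ∧ ∃ K : ℝ, ∀ u : ℕ → E, ‖u 0 - x‖ < ε → (∀ k, u (k + 1) = N (u k)) →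
      Tendsto u atTop (𝓝 x) ∧
      (∀ k, ‖u (k + 1) - u (k + 2)‖ ≤ K * ‖u k - u (k + 1)‖ ^ 2) ∧
      (∀ k, ‖u (k + 1) - x‖ ≤ K * ‖u k - x‖ ^ 2) := by
  obtain ⟨c, hc, h⟩ := hN.exists_pos
  obtain ⟨δ, hδ, hball⟩ := Metric.eventually_nhds_iff.1 h.bound
  refine ⟨min δ (1 / (2 * c)), by positivity, 8 * c, fun u h0 hu => ?_⟩
  have hstep : ∀ v, ‖v - x‖ < min δ (1 / (2 * c)) →
      ‖N v - x‖ ≤ c * ‖v - x‖ ^ 2 ∧ ‖N v - x‖ ≤ 1 / 2 * ‖v - x‖ := by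
    intro v hv
    have h1 := hball (y := v) (by rw [dist_eq_norm]; exact hv.trans_le (min_le_left _ _))
    rw [norm_pow, norm_norm] at h1
    refine ⟨h1, h1.trans ?_⟩
    have h2 : c * ‖v - x‖ ≤ 1 / 2 := by
      have := (hv.trans_le (min_le_right _ _)).le
      rw [le_div_iff₀ (by positivity)] at this
      linarith
    rw [pow_two, ← mul_assoc]
    exact mul_le_mul_of_nonneg_right h2 (norm_nonneg _)
  have hk : ∀ k, ‖u k - x‖ < min δ (1 / (2 * c)) ∧ ‖u k - x‖ ≤ (1 / 2) ^ k * ‖u 0 - x‖ := by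
    intro k
    induction k with
    | zero => exact ⟨h0, by simp⟩
    | succ k ih =>
      have h1 := (hstep _ ih.1).2
      rw [hu]
      refine ⟨lt_of_le_of_lt (h1.trans ?_) ih.1, h1.trans ?_⟩
      · linarith [norm_nonneg (u k - x)]
      · rw [pow_succ']; linarith [ih.2]
  refine ⟨?_, fun k => ?_, fun k => ?_⟩
  · rw [tendsto_iff_norm_sub_tendsto_zero]
    refine squeeze_zero (fun _ => norm_nonneg _) (fun k => (hk k).2) ?_
    simpa using (tendsto_pow_atTop_nhds_zero_of_lt_one (r := (1 / 2 : ℝ)) (by norm_num)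
      (by norm_num)).mul_const ‖u 0 - x‖
  · have h1 := hstep _ (hk k).1
    have h2 := hstep _ (hk (k + 1)).1
    rw [← hu] at h1 h2
    have h3 : ‖u (k + 1) - u (k + 2)‖ ≤ ‖u (k + 1) - x‖ + ‖u (k + 2) - x‖ := by
      rw [← sub_sub_sub_cancel_right (u (k + 1)) (u (k + 2)) x]; exact norm_sub_le _ _
    have h4 : ‖u k - x‖ ≤ ‖u k - u (k + 1)‖ + ‖u (k + 1) - x‖ := by
      rw [← sub_add_sub_cancel (u k) (u (k + 1)) x]; exact norm_add_le _ _
    have h5 : ‖u k - x‖ ≤ 2 * ‖u k - u (k + 1)‖ := by linarith [h1.2]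
    have h6 : ‖u k - x‖ ^ 2 ≤ (2 * ‖u k - u (k + 1)‖) ^ 2 :=
      pow_le_pow_left₀ (norm_nonneg _) h5 2
    have h7 := mul_le_mul_of_nonneg_left h6 hc.le
    linarith [h1.1, h2.2, norm_nonneg (u (k + 1) - x)]
  · have h1 := (hstep _ (hk k).1).1
    rw [← hu] at h1
    have : 0 ≤ c * ‖u k - x‖ ^ 2 := by positivity
    linarith

theorem pinv_eq {m n : Type} [Fintype m] [Fintype n] [DecidableEq n] {A : Matrix m n ℂ}
    (hA : (Aᴴ * A).det ≠ 0) : pinv A = (Aᴴ * A)⁻¹ * Aᴴ := by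
  have h1 : (Aᴴ * A)⁻¹ * Aᴴ * A = 1 := by
    rw [Matrix.mul_assoc]; exact nonsing_inv_mul _ (isUnit_iff_ne_zero.2 hA)
  have hN : ((Aᴴ * A)⁻¹)ᴴ = (Aᴴ * A)⁻¹ := by
    rw [conjTranspose_nonsing_inv, conjTranspose_mul, conjTranspose_conjTranspose]
  refine (pinv_spec A).unique ⟨?_, ?_, ?_, ?_⟩
  · rw [Matrix.mul_assoc, h1, Matrix.mul_one]
  · rw [h1, Matrix.one_mul]
  · rw [conjTranspose_mul, conjTranspose_mul, conjTranspose_conjTranspose, hN, Matrix.mul_assoc]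
  · rw [h1, conjTranspose_one]

theorem continuousAt_matrix_mul {Y m n p : Type} [TopologicalSpace Y] [Fintype n]
    {A : Y → Matrix m n ℂ} {B : Y → Matrix n p ℂ} {y : Y} (hA : ContinuousAt A y)
    (hB : ContinuousAt B y) : ContinuousAt (fun u => A u * B u) y := by
  have h : Continuous fun q : Matrix m n ℂ × Matrix n p ℂ => q.1 * q.2 :=
    continuous_fst.matrix_mul continuous_snd
  exact ContinuousAt.comp (g := fun q : Matrix m n ℂ × Matrix n p ℂ => q.1 * q.2)
    (f := fun u => (A u, B u)) h.continuousAt (hA.prodMk hB)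

section Newton

variable {σ ι : Type} [Fintype σ] {F : ι → MvPolynomial σ ℂ} {x : σ → ℂ}

open Asymptotics

theorem isBigO_of_mem_pointIdeal {p : MvPolynomial σ ℂ} (hp : p ∈ pointIdeal x) :
    (fun u => eval u p) =O[𝓝 x] fun u => ‖u - x‖ := by
  rw [pointIdeal_eq_span] at hp
  induction hp using Submodule.span_induction with
  | mem p hp =>
    obtain ⟨j, rfl⟩ := hp
    refine IsBigO.of_norm_le fun u => ?_
    rw [map_sub, eval_X, eval_C]
    exact norm_le_pi_norm (u - x) j
  | zero => simpa using isBigO_zero _ _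
  | add p q _ _ hp hq => simpa using hp.add hq
  | smul a p _ ih =>
    have := ((MvPolynomial.continuous_eval a).tendsto x).isBigO_one ℝ |>.mul ih
    simpa using this

theorem isBigO_of_mem_pointIdeal_sq {p : MvPolynomial σ ℂ} (hp : p ∈ pointIdeal x ^ 2) :
    (fun u => eval u p) =O[𝓝 x] fun u => ‖u - x‖ ^ 2 := by
  rw [pow_two] at hp
  induction hp using Submodule.mul_induction_on' with
  | mem_mul_mem p hp q hq =>
    simpa [pow_two] using (isBigO_of_mem_pointIdeal hp).mul (isBigO_of_mem_pointIdeal hq)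
  | add p _ q _ hp hq => simpa using hp.add hq

theorem newton_remainder_mem (p : MvPolynomial σ ℂ) (hp : eval x p = 0) :
    ∑ j, pderiv j p * (X j - C (x j)) - p ∈ pointIdeal x ^ 2 := by
  have h1 := taylor_mem_pointIdeal_sq x p
  have h2 : ∑ j, (pderiv j p - C (eval x (pderiv j p))) * (X j - C (x j)) ∈ pointIdeal x ^ 2 := by
    rw [pow_two]
    refine Ideal.sum_mem _ fun j _ => Ideal.mul_mem_mul ?_ (X_sub_C_mem_pointIdeal x j)
    simp [RingHom.mem_ker]
  convert Ideal.sub_mem _ h2 h1 using 1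
  simp only [hp, map_zero, sub_mul, Finset.sum_sub_distrib]
  ring

/-- Near a regular root `Aᴴ * A` stays invertible, so `A⁺ = (Aᴴ * A)⁻¹ * Aᴴ` is a left inverse of
`A`, and this formula is continuous at `x`. The Newton error is therefore a bounded matrix times a
second-order remainder. -/
theorem IsRegularAt.newtonConvergesQuadratically [Fintype ι] (h : IsRegularAt F x)
    (hF : evalSystem F x = 0) : NewtonConvergesQuadratically F x := by
  classical
  refine quadratic_convergence ?_
  have hJ : Continuous fun u => jacobianAt F u :=
    continuous_matrix fun i j => MvPolynomial.continuous_eval _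
  have hJH : Continuous fun u => (jacobianAt F u)ᴴ * jacobianAt F u :=
    hJ.matrix_conjTranspose.matrix_mul hJ
  have hdet : ((jacobianAt F x)ᴴ * jacobianAt F x).det ≠ 0 := by
    rw [← isUnit_iff_ne_zero, ← isUnit_iff_isUnit_det, ← mulVec_injective_iff_isUnit]
    refine (injective_iff_map_eq_zero (mulVecLin _)).2 fun v hv => ?_
    open scoped ComplexOrder in
    have h0 := (conjTranspose_mul_self_mulVec_eq_zero _ v).1 hv
    exact isRegularAt_iff_injective.1 h (h0.trans (mulVec_zero _).symm)
  have hP : ContinuousAt (fun u =>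
      ((jacobianAt F u)ᴴ * jacobianAt F u)⁻¹ * (jacobianAt F u)ᴴ) x := by
    simp only [Matrix.inv_def, Ring.inverse_eq_inv']
    have h1 : ContinuousAt (fun u => (((jacobianAt F u)ᴴ * jacobianAt F u).det)⁻¹ •
        ((jacobianAt F u)ᴴ * jacobianAt F u).adjugate) x :=
      (hJH.matrix_det.continuousAt.inv₀ hdet).smul hJH.matrix_adjugate.continuousAt
    exact continuousAt_matrix_mul h1 hJ.matrix_conjTranspose.continuousAt
  have hR : ∀ i, (fun u => (jacobianAt F u *ᵥ (u - x) - evalSystem F u) i)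
      =O[𝓝 x] fun u => ‖u - x‖ ^ 2 := by
    intro i
    refine (isBigO_of_mem_pointIdeal_sq (newton_remainder_mem (F i) (congrFun hF i))).congr_left
      fun u => ?_
    simp [jacobianAt, mulVec, dotProduct, evalSystem]
  have hO : (fun u => (((jacobianAt F u)ᴴ * jacobianAt F u)⁻¹ * (jacobianAt F u)ᴴ) *ᵥ
      (jacobianAt F u *ᵥ (u - x) - evalSystem F u)) =O[𝓝 x] fun u => ‖u - x‖ ^ 2 := by
    refine isBigO_pi.2 fun j => IsBigO.fun_sum (s := Finset.univ) fun i _ => ?_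
    have h1 : ContinuousAt (fun u =>
        (((jacobianAt F u)ᴴ * jacobianAt F u)⁻¹ * (jacobianAt F u)ᴴ) j i) x :=
      (continuous_apply_apply j i).continuousAt.comp hP
    simpa using (h1.tendsto.isBigO_one ℝ).mul (hR i)
  refine hO.congr' ?_ EventuallyEq.rfl
  filter_upwards [hJH.matrix_det.continuousAt.eventually_ne hdet] with u hu
  rw [newtonStep, pinv_eq hu, mulVec_sub, mulVec_mulVec, Matrix.mul_assoc,
    nonsing_inv_mul _ (isUnit_iff_ne_zero.2 hu), one_mulVec]
  abel

end Newton

/-! ### Repeated deflation -/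

theorem ForGeneric.mono {σ : Type} {s : ℕ} {p q : Matrix σ (Fin s) ℂ → (Fin s → ℂ) → Prop}
    (hp : ForGeneric p) (hpq : ∀ B h, p B h → q B h) : ForGeneric q := by
  obtain ⟨Q, hQ, hQ'⟩ := hp
  exact ⟨Q, hQ, fun B h hB => hpq B h (hQ' B h hB)⟩

theorem NeedsAtMost.succ : ∀ {k : ℕ} {σ ι : Type} [Fintype σ] [Fintype ι]
    {F : ι → MvPolynomial σ ℂ} {x : σ → ℂ}, NeedsAtMost k F x → NeedsAtMost (k + 1) F x
  | 0, _, _, _, _, _, _, h => Or.inl h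
  | _ + 1, _, _, _, _, _, _, h => h.imp id fun h =>
      ⟨h.1, h.2.mono fun _ _ ⟨l, h1, h2, h3⟩ => ⟨l, h1, h2, NeedsAtMost.succ h3⟩⟩

theorem NeedsAtMost.mono {σ ι : Type} [Fintype σ] [Fintype ι] {F : ι → MvPolynomial σ ℂ}
    {x : σ → ℂ} {k m : ℕ} (hkm : k ≤ m) (h : NeedsAtMost k F x) : NeedsAtMost m F x := by
  induction hkm with
  | refl => exact h
  | step _ ih => exact ih.succ

variable {σ ι : Type} [Fintype σ] [Fintype ι] {F : ι → MvPolynomial σ ℂ} {x : σ → ℂ}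

/-- At a singular isolated solution, one random deflation determines the multipliers uniquely, and
gives an isolated solution of positive, strictly smaller multiplicity. -/
theorem forGeneric_multiplicity_lt (hx : IsIsolatedSolution F x) (hs : ¬ IsRegularAt F x) :
    ForGeneric fun (B : Matrix σ (Fin ((jacobianAt F x).rank + 1)) ℂ)
      (h : Fin ((jacobianAt F x).rank + 1) → ℂ) =>
      ∃ l, IsMultiplier F x B h l ∧ IsIsolatedSolution (deflate F B h) (Sum.elim x l) ∧
        0 < multiplicity (deflate F B h) (Sum.elim x l) ∧
        multiplicity (deflate F B h) (Sum.elim x l) < multiplicity F x :=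
  (forGeneric_isMultiplier hx.evalSystem_eq_zero hs).mono fun _ _ ⟨l, hl, hBl⟩ =>
    ⟨l, hl, hl.isIsolatedSolution hx, (hl.isIsolatedSolution hx).multiplicity_pos,
      hl.multiplicity_lt hx hBl⟩

/-- The induction quantifies over all systems because each deflation changes the unknowns and the
equations; the bound depends on the multiplicity alone, hence not on the random choices. -/
theorem needsAtMost_of_multiplicity_le (k : ℕ) : ∀ {σ ι : Type} [Fintype σ] [Fintype ι]
    {F : ι → MvPolynomial σ ℂ} {x : σ → ℂ}, IsIsolatedSolution F x →
    multiplicity F x ≤ k + 1 → NeedsAtMost k F x := by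
  induction k with
  | zero =>
    intro σ ι _ _ F x hx hm
    have hr : IsRegularAt F x := (multiplicity_eq_one_iff hx.evalSystem_eq_zero).1
      (le_antisymm hm hx.multiplicity_pos)
    exact ⟨hr, hr.newtonConvergesQuadratically hx.evalSystem_eq_zero⟩
  | succ k ih =>
    intro σ ι _ _ F x hx hm
    by_cases hr : IsRegularAt F x
    · exact Or.inl ⟨hr, hr.newtonConvergesQuadratically hx.evalSystem_eq_zero⟩
    · exact Or.inr ⟨hr, (forGeneric_multiplicity_lt hx hr).mono
        fun _ _ ⟨l, h1, h2, _, h4⟩ => ⟨l, h1, h2, ih h2 (by lia)⟩⟩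

end Deflation

end

/-! ### The main theorem -/

theorem mainTheorem1 (n N m : ℕ) (F : Fin N → MvPolynomial (Fin n) ℂ) (x : Fin n → ℂ)
    (hx : Deflation.IsIsolatedSolution F x) (hm : Deflation.multiplicity F x = m) :
    (∃ k < m, Deflation.NeedsAtMost k F x) ∧
    (¬ Deflation.IsRegularAt F x →
      Deflation.ForGeneric fun
          (B : Matrix (Fin n) (Fin ((Deflation.jacobianAt F x).rank + 1)) ℂ)
          (h : Fin ((Deflation.jacobianAt F x).rank + 1) → ℂ) =>
        ∃ l, Deflation.IsMultiplier F x B h l ∧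
          Deflation.IsIsolatedSolution (Deflation.deflate F B h) (Sum.elim x l) ∧
          0 < Deflation.multiplicity (Deflation.deflate F B h) (Sum.elim x l) ∧
          Deflation.multiplicity (Deflation.deflate F B h) (Sum.elim x l) < m) ∧
    (m = 1 ↔ Deflation.IsRegularAt F x) := by
  subst hm
  have hpos := hx.multiplicity_pos
  refine ⟨⟨Deflation.multiplicity F x - 1, by lia,
    Deflation.needsAtMost_of_multiplicity_le _ hx (by lia)⟩,
    Deflation.forGeneric_multiplicity_lt hx,
    Deflation.multiplicity_eq_one_iff hx.evalSystem_eq_zero⟩
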